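/- **Setting.** Let $F=\mathbb C((z))$, $\mathfrak o=\mathbb C[[z]]$, $n=ke$ with $e\ge 1$, and index the standard basis of $F^n$ by pairs $(j,a)$, $1\le j\le k$, $0\le a<e$. Let $\varpi_T\in\mathfrak{gl}_n(F)$ be block diagonal with $k$ equal $e\times e$ blocks having $1$ on the superdiagonal, $z$ in the lower left corner and $0$ elsewhere. Put $L^i=\varpi_T^i\mathfrak o^n$, $\mathfrak P^\ell=\{X\in\mathfrak{gl}_n(F): XL^i\subset L^{i+\ell}\ \forall i\}$, $\mathfrak P=\mathfrak P^0$, $P=\{p\in GL_n(F): pL^i=L^i\ \forall i\}$ and $P^1=1+\mathfrak P^1$. Let $\chi_j$ be the identity of the $j$-th block, $\mathfrak t^\flat=\bigoplus_j\mathbb C\chi_j$, and let $\mathfrak t\cong E^{k}$, $E=F[\varpi]$, be the algebra of Laurent series in $\varpi_T$ with coefficients in $\mathfrak t^\flat$; $T=\mathfrak t^\times$. Let $H_T$ be block diagonal with all blocks $\mathrm{diag}(\tfrac{e-1}{2e},\tfrac{e-3}{2e},\dots,\tfrac{1-e}{2e})$. Functionals on $\mathfrak P^r/\mathfrak P^{r+1}$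 and on $\mathfrak P/\mathfrak P^{r+1}$ are represented by elements of $\mathfrak P^{-r}$, modulo $\mathfrak P^{-r+1}$ and $\mathfrak P^1$ respectively, through $\langle X,Y\rangle=\mathrm{Res}\,\mathrm{Tr}(XY\frac{dz}{z})$. For $r\ge 0$, a triple $(P,r,\beta)$ with $\beta$ represented by $b\in\mathfrak P^{-r}$ is a *regular stratum centralized by $T$* if: $\gcd(r,e)=1$; $b+\mathfrak P^{-r+1}$ contains no nilpotent element; $T(\mathfrak o)\subset P$; for every $s$ the kernel of $X\mapsto[X,b]$, $\mathfrak P^s/\mathfrak P^{s+1}\to\mathfrak P^{s-r}/\mathfrak P^{s-r+1}$, is the image of $\mathfrak t\cap\mathfrak P^s$; the class of $z^rb^e$ in $\mathfrak P/\mathfrak P^1$ is semisimple; and, if $r=0$, the $n$ eigenvalues of the class of $b$ in $\mathfrak P/\mathfrak P^1$ (which is $\mathfrak{gl}_n(\mathbb C)$, as then $e=1$) are distinct modulo $\mathbb Z$. With $\nabla_\tau=z\partial_z+M$, the connection $d+M\frac{dz}{z}$ *contains* $(P,r,\beta)$ if, for $r\ge1$, $\nabla_\tau L^i\subset L^{i-r}$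 and $(\nabla_\tau-b)L^i\subset L^{i-r+1}$ for all $i$, and, for $r=0$, $(\nabla_\tau-b)L^i\subset L^{i+1}$ for some $i$. An element $A\in\mathfrak P^{-r}$ represents a *formal type* if it defines a regular stratum centralized by $T$ and $A\in\mathfrak t+\mathfrak P^1$; $d+M\frac{dz}z$ *has formal type $A$* if moreover it contains this stratum and is gauge equivalent, by an element of $P^1$, to an element of $(A+\mathfrak P^1)\frac{dz}z$. Let $\Delta\subset\mathbb C^m$ be an open polydisk with ring of holomorphic functions $R$. A meromorphic connection on the trivial rank $n$ bundle $\bar V$ over $\mathrm{Spec}(\mathfrak o)\times\Delta$ is given, in a trivialization, by a matrix $\Omega=Z\frac{dz}z+\sum_jY_j\,dy_j$ of one-forms with $Z,Y_j\in\mathfrak{gl}_n(R((z)))$; it is flat if $d\Omega+\Omega\wedge\Omega=0$. For $h\in GL_n(R((z)))$ write $h\cdot\Omega=h\Omega h^{-1}-(d_zh)h^{-1}$, so that the full gauge transform is $h\cdot\Omega-(d_\Delta h)h^{-1}$. A *framed formal flat deformation* is a flat such connection $\bar\nabla$ with a framing $g\in GL_n(R)$ such that, for all $y\in\Delta$, the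 restriction to $\mathrm{Spec}(\mathfrak o)\times\{y\}$ of the matrix $[\bar\nabla]_g$ of $\bar\nabla$ in the trivialization $g$ contains a regular stratum $(P,r,\beta_y)$ centralized by $T$. Let $P_\Delta$ be the group of $p\in GL_n(R((z)))$ preserving the lattice chain $\varpi_T^iR[[z]]^n$. Fix a nonzero one-form $\nu=u\frac{dz}z$, $u\in F^\times$. For $t_{-r},\dots,t_0\in\mathfrak t^\flat\otimes R$ put $$A_{\frac{dz}z}=\sum_{i=-r}^{-1}\tfrac ie\,t_i\varpi_T^i+t_0,\qquad \tilde A_\nu=u^{-1}\bigl(A_{\frac{dz}z}+H_T\bigr),\qquad A_\Delta=\sum_{i=-r}^{-1}\varpi_T^i\,d_\Delta t_i .$$ **Proposition.** (1) Let $(\bar\nabla,g)$ be a framed formal flat deformation, let $t_i\in\mathfrak t^\flat\otimes R$ be such that $A_{\frac{dz}z}(y)$ represents the formal type of $[\bar\nabla]_g$ at every $y\in\Delta$, and let $p\in P_\Delta$ be such that the $dz$-part of $p\cdot[\bar\nabla]_g$ is $\tilde A_\nu\nu$. Then $$p\cdot[\bar\nabla]_g-(d_\Delta p)p^{-1}=\tilde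 A_\nu\nu+A_\Delta+f$$ for some closed $f\in\Omega^1_\Delta(\mathfrak t^\flat)$, and $t_0$ is constant on $\Delta$. (2) Conversely, if $t_i\in\mathfrak t^\flat\otimes R$ with $t_0$ constant, $f\in\Omega^1_\Delta(\mathfrak t^\flat)$ is closed and $q\in GL_n(R((z)))$, then $[\bar\nabla']=q^{-1}\cdot(\tilde A_\nu\nu+A_\Delta+f)+q^{-1}(d_\Delta q)$ is the matrix of a flat meromorphic connection $\bar\nabla'$ on $\bar V$. -/

import Mathlib

noncomputable section

namespace FormalDeformation

open scoped Topology

/-! ### Holomorphic functions on an open subset of `ℂ^m` -/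

/-- The open polydisk with centre `c` and polyradius `ρ`. -/
def polydisk {m : ℕ} (c : Fin m → ℂ) (ρ : Fin m → ℝ) : TopologicalSpace.Opens (Fin m → ℂ) :=
  ⟨Set.pi Set.univ fun i => Metric.ball (c i) (ρ i),
    isOpen_set_pi Set.finite_univ fun _ _ => Metric.isOpen_ball⟩

/-- The ring of holomorphic functions on the open set `U`. -/
def Hol {m : ℕ} (U : TopologicalSpace.Opens (Fin m → ℂ)) : Subalgebra ℂ (U → ℂ) where
  carrier := {f | ∃ F : (Fin m → ℂ) → ℂ, AnalyticOnNhd ℂ F U ∧ ∀ y : U, f y = F y}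
  mul_mem' := by
    rintro f g ⟨F, hF, hf⟩ ⟨G, hG, hg⟩
    exact ⟨F * G, hF.mul hG, fun y => by simp [hf y, hg y]⟩
  add_mem' := by
    rintro f g ⟨F, hF, hf⟩ ⟨G, hG, hg⟩
    exact ⟨F + G, hF.add hG, fun y => by simp [hf y, hg y]⟩
  algebraMap_mem' := fun a => ⟨fun _ => a, analyticOnNhd_const, fun _ => rfl⟩

section

variable {m : ℕ} {U : TopologicalSpace.Opens (Fin m → ℂ)}

/-- Extension of a holomorphic function on `U` by zero to `ℂ^m`. -/
def Hol.ext0 (f : Hol U) : (Fin m → ℂ) → ℂ :=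
  Function.extend Subtype.val (f : U → ℂ) 0

theorem Hol.ext0_apply (f : Hol U) (y : U) : Hol.ext0 f (y : Fin m → ℂ) = (f : U → ℂ) y :=
  Subtype.val_injective.extend_apply _ _ _

theorem Hol.analytic_ext0 (f : Hol U) : AnalyticOnNhd ℂ (Hol.ext0 f) U := by
  obtain ⟨F, hF, h⟩ := f.2
  exact hF.congr U.isOpen fun y hy => by
    rw [← h ⟨y, hy⟩]
    exact (Hol.ext0_apply f ⟨y, hy⟩).symm

theorem Hol.eventuallyEq_of_forall {F G : (Fin m → ℂ) → ℂ} (h : ∀ y : U, F y = G y) (y : U) :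
    F =ᶠ[𝓝 (y : Fin m → ℂ)] G :=
  Filter.eventuallyEq_of_mem (U.isOpen.mem_nhds y.2) fun x hx => h ⟨x, hx⟩

/-- The partial derivative `∂/∂y_j` of holomorphic functions on `U`. -/
def Hol.pderiv (j : Fin m) : Hol U →ₗ[ℂ] Hol U where
  toFun f := ⟨fun y => fderiv ℂ (Hol.ext0 f) y (Pi.single j 1),
    fun y => fderiv ℂ (Hol.ext0 f) y (Pi.single j 1),
    fun y hy => ((ContinuousLinearMap.apply ℂ ℂ (Pi.single j (1 : ℂ) : Fin m → ℂ)).analyticAt _).comp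
      ((Hol.analytic_ext0 f).fderiv y hy), fun _ => rfl⟩
  map_add' f g := by
    ext y
    have h : Hol.ext0 (f + g) =ᶠ[𝓝 (y : Fin m → ℂ)] Hol.ext0 f + Hol.ext0 g :=
      Hol.eventuallyEq_of_forall (fun x => by simp [Hol.ext0_apply]) y
    have hf := (Hol.analytic_ext0 f y y.2).differentiableAt
    have hg := (Hol.analytic_ext0 g y y.2).differentiableAt
    simp [h.fderiv_eq, fderiv_add hf hg]
  map_smul' a f := by
    ext y
    have h : Hol.ext0 (a • f) =ᶠ[𝓝 (y : Fin m → ℂ)] a • Hol.ext0 f :=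
      Hol.eventuallyEq_of_forall (fun x => by simp [Hol.ext0_apply]) y
    have hf := (Hol.analytic_ext0 f y y.2).differentiableAt
    simp [h.fderiv_eq, fderiv_const_smul hf]

/-- Evaluation of holomorphic functions at a point of `U`. -/
def Hol.eval (y : U) : Hol U →+* ℂ :=
  (Pi.evalRingHom (fun _ : U => ℂ) y).comp (Hol U).val.toRingHom

end

/-! ### Laurent series and matrices

`S((z))` is `LaurentSeries S`.  Matrices of size `n = k * e` are indexed by pairs `(j, a)` with
`j < k` the number of the block and `a < e` the position in the block. -/

/-- `gl_n(S((z)))`, with `n = k * e`. -/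
abbrev Mat (k e : ℕ) (S : Type*) [CommRing S] : Type _ :=
  Matrix (Fin k × Fin e) (Fin k × Fin e) (LaurentSeries S)

/-- The derivation `z ∂_z` of `S((z))`. -/
def zdz {S : Type*} [CommRing S] (x : LaurentSeries S) : LaurentSeries S where
  coeff l := l • x.coeff l
  isPWO_support' := x.isPWO_support.mono fun l hl h => hl (by simp [h])

section

variable {S : Type*} [CommRing S]

/-- `z ∂_z` applied to every entry of a matrix. -/
def zdzMat {k e : ℕ} (X : Mat k e S) : Mat k e S := X.map zdz

/-- The uniform lattice chain of period `e` given by `L^i = ϖ_T^i S[[z]]^n`, in coordinates: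
the monomial vector `z^l e_{(j,a)}` lies in `L^i` if and only if `i ≤ l e + (e - 1 - a)`. -/
def chain (S : Type*) [CommRing S] (k e : ℕ) (i : ℤ) : Set (Fin k × Fin e → LaurentSeries S) :=
  {v | ∀ (j : Fin k) (a : Fin e) (l : ℤ),
    (v (j, a)).coeff l ≠ 0 → i ≤ l * e + (e - 1 - (a : ℕ))}

/-- `𝔓^ℓ`: the matrices `X` with `X L^i ⊆ L^{i+ℓ}` for all `i`. -/
def par (S : Type*) [CommRing S] (k e : ℕ) (ℓ : ℤ) : Set (Mat k e S) :=
  {X | ∀ i : ℤ, ∀ v ∈ chain S k e i, X.mulVec v ∈ chain S k e (i + ℓ)}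

/-- The standard uniform parahoric subgroup `P`, the stabilizer of the lattice chain. -/
def parahoric (S : Type*) [CommRing S] (k e : ℕ) :
    Set (GL (Fin k × Fin e) (LaurentSeries S)) :=
  {p | (p : Mat k e S) ∈ par S k e 0 ∧ ((p⁻¹ : GL _ _) : Mat k e S) ∈ par S k e 0}

/-- `ϖ_T`: block diagonal, each of its `k` blocks being the `e × e` matrix with `1` on the
superdiagonal, `z` in the lower left corner and `0` elsewhere. -/
def varpi (S : Type*) [CommRing S] (k e : ℕ) : Mat k e S :=
  Matrix.of fun p q =>
    if p.1 = q.1 then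
      if (p.2 : ℕ) + 1 = q.2 then 1
      else if (p.2 : ℕ) + 1 = e ∧ (q.2 : ℕ) = 0 then HahnSeries.single (1 : ℤ) (1 : S) else 0
    else 0

/-- `𝔱 ≅ E^k` with `E = S((z))[ϖ]`, the block diagonal matrices whose `j`-th block is
`∑_{a < e} c_{j,a} ϖ^a` with `c_{j,a} ∈ S((z))`. -/
def toral {k e : ℕ} (c : Fin k → Fin e → LaurentSeries S) : Mat k e S :=
  ∑ a : Fin e, Matrix.diagonal (fun p => c p.1 a) * varpi S k e ^ (a : ℕ)

/-- The element `∑_j d_j χ_j` of `𝔱^♭`, where `χ_j` is the identity of the `j`-th block. -/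
def flatMat {k : ℕ} (e : ℕ) (d : Fin k → S) : Mat k e S :=
  Matrix.diagonal fun p => HahnSeries.C (d p.1)

/-- `H_T`: block diagonal with blocks `diag((e-1)/(2e), (e-3)/(2e), …, (1-e)/(2e))`. -/
def HT (S : Type*) [CommRing S] [Algebra ℂ S] (k e : ℕ) : Mat k e S :=
  Matrix.diagonal fun p =>
    HahnSeries.C (algebraMap ℂ S (((e : ℂ) - 1 - 2 * ((p.2 : ℕ) : ℂ)) / (2 * (e : ℂ))))

/-- `(dz/z)`-coefficient of the `d_z`-part of the gauge transformation by `h`: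
`Ad(h) X - (z ∂_z h) h⁻¹`. -/
def gaugeMat {k e : ℕ} (h : GL (Fin k × Fin e) (LaurentSeries S)) (X : Mat k e S) : Mat k e S :=
  (h : Mat k e S) * X * ((h⁻¹ : GL _ _) : Mat k e S)
    - zdzMat (h : Mat k e S) * ((h⁻¹ : GL _ _) : Mat k e S)

/-- The inclusion `GL_n(S) ⊆ GL_n(S((z)))`. -/
def constGL {k e : ℕ} (g : GL (Fin k × Fin e) S) : GL (Fin k × Fin e) (LaurentSeries S) :=
  Matrix.GeneralLinearGroup.map (HahnSeries.C : S →+* LaurentSeries S) g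

end

/-- `ϖ_T` is invertible, so that its negative powers `ϖ_T ^ i` are the genuine ones. -/
theorem isUnit_det_varpi (S : Type*) [CommRing S] (k e : ℕ) [NeZero e] :
    IsUnit (varpi S k e).det := by
  let W : Mat k e S := Matrix.of fun p q =>
    if p.1 = q.1 then
      if (q.2 : ℕ) + 1 = p.2 then 1
      else if (q.2 : ℕ) + 1 = e ∧ (p.2 : ℕ) = 0 then HahnSeries.single (-1 : ℤ) (1 : S) else 0
    else 0
  refine Matrix.isUnit_det_of_right_inverse (B := W) ?_
  have he : 0 < e := Nat.pos_of_ne_zero (NeZero.ne e)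
  ext ⟨j, a⟩ ⟨j', b⟩ : 1
  rw [Matrix.mul_apply, Matrix.one_apply]
  by_cases ha : (a : ℕ) + 1 < e
  · rw [Finset.sum_eq_single (j, ⟨(a : ℕ) + 1, ha⟩)]
    · by_cases hj : j = j'
      · by_cases hab : a = b
        · simp [varpi, W, hj, hab]
        · have : (b : ℕ) ≠ a := fun h => hab (Fin.ext h.symm)
          simp [varpi, W, hj, hab, this]
      · simp [varpi, W, hj]
    · rintro ⟨j₁, a₁⟩ - hne
      have h1 : j = j₁ → (a : ℕ) + 1 ≠ a₁ := fun h h' => hne (by ext <;> simp [h, h'])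
      have h2 : (a : ℕ) + 1 ≠ e := ha.ne
      by_cases hj : j = j₁
      · simp [varpi, hj, h1 hj, h2]
      · simp [varpi, hj]
    · simp
  · have ha' : (a : ℕ) + 1 = e := by have := a.2; omega
    rw [Finset.sum_eq_single (j, ⟨0, he⟩)]
    · by_cases hj : j = j'
      · by_cases hab : a = b
        · subst hab
          simp [varpi, W, hj, ha', he.ne']
        · have : (b : ℕ) + 1 ≠ e := fun h => hab (Fin.ext (by omega))
          simp [varpi, W, hj, hab, this]
      · simp [varpi, W, hj]
    · rintro ⟨j₁, a₁⟩ - hne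
      have h1 : j = j₁ → (a₁ : ℕ) ≠ 0 := fun h h' => hne (by ext <;> simp [h, h'])
      have h2 : (a : ℕ) + 1 ≠ a₁ := by have := a₁.2; omega
      by_cases hj : j = j₁
      · simp only [varpi, Matrix.of_apply, if_pos hj, if_neg h2, h1 hj, and_false, if_false, zero_mul]
      · simp [varpi, hj]
    · simp

/-! ### Strata and formal types over `F = ℂ((z))`

A functional on `𝔓^r/𝔓^{r+1}` (or on `𝔓/𝔓^{r+1}`) is given by a representative `b ∈ 𝔓^{-r}`
with respect to the pairing `⟨X, Y⟩ = Res Tr (X Y dz/z)`; it depends only on the class of `b`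
modulo `𝔓^{-r+1}` (respectively modulo `𝔓^1`). -/

/-- The stratum `(P, r, β)`, with `β` represented by `b`, is a uniform stratum which is regular and
centralized by `T`. -/
structure IsRegularStratum {k e : ℕ} (r : ℕ) (b : Mat k e ℂ) : Prop where
  coprime : Nat.Coprime r e
  mem : b ∈ par ℂ k e (-r)
  /-- the coset `b + 𝔓^{-r+1}` contains no nilpotent element -/
  not_nilpotent : ∀ X : Mat k e ℂ, X - b ∈ par ℂ k e (-r + 1) → ¬ IsNilpotent X
  /-- `𝔱(𝔬) ⊆ 𝔓`, that is, `T(𝔬) ⊆ P` -/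
  torus_le : ∀ c : Fin k → Fin e → LaurentSeries ℂ,
    (∀ j a l, (c j a).coeff l ≠ 0 → 0 ≤ l) → toral c ∈ par ℂ k e 0
  /-- the kernel of `X ↦ [X, b]` from `𝔓^s/𝔓^{s+1}` to `𝔓^{s-r}/𝔓^{s-r+1}` is the image of
  `𝔱 ∩ 𝔓^s` -/
  ker_ad : ∀ s : ℤ, ∀ X ∈ par ℂ k e s,
    X * b - b * X ∈ par ℂ k e (s - r + 1) ↔
      ∃ c : Fin k → Fin e → LaurentSeries ℂ,
        toral c ∈ par ℂ k e s ∧ X - toral c ∈ par ℂ k e (s + 1)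
  /-- the class of `z^r b^e` in the finite-dimensional algebra `𝔓/𝔓^1` is semisimple, that is,
  killed by a squarefree polynomial -/
  semisimple : ∃ f : Polynomial ℂ, Squarefree f ∧
    Polynomial.aeval ((HahnSeries.single (r : ℤ) (1 : ℂ) : LaurentSeries ℂ) • b ^ e) f
      ∈ par ℂ k e 1
  /-- for `r = 0` (hence `e = 1`, `𝔓/𝔓^1 = gl_n(ℂ)`), the `n` eigenvalues of the class of `b` are
  distinct modulo `ℤ` -/
  distinct : r = 0 →
    (b.map fun x => x.coeff 0).charpoly.roots.Nodup ∧
    ∀ x ∈ (b.map fun x => x.coeff 0).charpoly.roots,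
      ∀ y ∈ (b.map fun x => x.coeff 0).charpoly.roots, ∀ l : ℤ, x - y = l → x = y

/-- The operator `∇_τ = z ∂_z + M` on `F^n` of the connection `d + M dz/z`, where `τ = z ∂_z`. -/
def nablaTau {k e : ℕ} (M : Mat k e ℂ) (v : Fin k × Fin e → LaurentSeries ℂ) :
    Fin k × Fin e → LaurentSeries ℂ :=
  (fun p => zdz (v p)) + M.mulVec v

/-- The connection `d + M dz/z` contains the stratum `(P, r, β)`, with `β` represented by `b`. -/
def ContainsStratum {k e : ℕ} (r : ℕ) (b M : Mat k e ℂ) : Prop :=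
  (1 ≤ r → ∀ i : ℤ, ∀ v ∈ chain ℂ k e i, nablaTau M v ∈ chain ℂ k e (i - r) ∧
    nablaTau M v - b.mulVec v ∈ chain ℂ k e (i - r + 1)) ∧
  (r = 0 → ∃ i : ℤ, ∀ v ∈ chain ℂ k e i, nablaTau M v - b.mulVec v ∈ chain ℂ k e (i + 1))

/-- `A` represents a formal type: the stratum which it induces on `𝔓^r/𝔓^{r+1}` is regular and
centralized by `T`, and `A ∈ 𝔱 + 𝔓^1`.  (That `𝔓^{r+1}` is the smallest congruence ideal killed by
the functional follows from the absence of nilpotent elements.) -/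
structure IsFormalType {k e : ℕ} (r : ℕ) (A : Mat k e ℂ) : Prop where
  regular : IsRegularStratum r A
  mem_torus : ∃ c : Fin k → Fin e → LaurentSeries ℂ, A - toral c ∈ par ℂ k e 1

/-- The connection `d + M dz/z` on `F^n` has the formal type represented by `A` (in the given
trivialization): it contains the stratum induced by `A`, and it is gauge equivalent to an element
of `(A + 𝔓^1) dz/z` by an element of `P^1 = 1 + 𝔓^1`. -/
structure HasFormalType {k e : ℕ} (r : ℕ) (M A : Mat k e ℂ) : Prop where
  isFormalType : IsFormalType r A
  contains : ContainsStratum r A M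
  gauge : ∃ h : GL (Fin k × Fin e) (LaurentSeries ℂ),
    (h : Mat k e ℂ) - 1 ∈ par ℂ k e 1 ∧ gaugeMat h M - A ∈ par ℂ k e 1

/-! ### Meromorphic connections on `D × U` -/

section

variable {m : ℕ} {U : TopologicalSpace.Opens (Fin m → ℂ)} {k e : ℕ}

/-- `∂/∂y_j` applied to every coefficient of every entry of a matrix over `R((z))`. -/
def pderivMat (j : Fin m) (X : Mat k e (Hol U)) : Mat k e (Hol U) :=
  X.map fun x => HahnSeries.map x (Hol.pderiv j)

/-- The value of a matrix over `R((z))` at the point `y`. -/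
def evalMat (y : U) (X : Mat k e (Hol U)) : Mat k e ℂ :=
  X.map fun x => HahnSeries.map x (Hol.eval y)

/-- The matrix of one-forms `Z dz/z + ∑_j Y_j dy_j` over `R((z))` of a meromorphic connection on the
trivial bundle of rank `n = k * e` over `D × U`, with poles along `z = 0`. -/
@[ext]
structure ConnForm (k e : ℕ) {m : ℕ} (U : TopologicalSpace.Opens (Fin m → ℂ)) where
  Z : Mat k e (Hol U)
  Y : Fin m → Mat k e (Hol U)

/-- Flatness of `d + Ω`, that is, `dΩ + Ω ∧ Ω = 0`: the coefficients of `dz/z ∧ dy_j` and of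
`dy_i ∧ dy_j` vanish. -/
def ConnForm.IsFlat (Ω : ConnForm k e U) : Prop :=
  (∀ j, zdzMat (Ω.Y j) - pderivMat j Ω.Z + (Ω.Z * Ω.Y j - Ω.Y j * Ω.Z) = 0) ∧
  (∀ i j, pderivMat i (Ω.Y j) - pderivMat j (Ω.Y i) + (Ω.Y i * Ω.Y j - Ω.Y j * Ω.Y i) = 0)

/-- The full gauge transformation `Ad(h) Ω - (d_z h) h⁻¹ - (d_Δ h) h⁻¹`. -/
def ConnForm.gauge (h : GL (Fin k × Fin e) (LaurentSeries (Hol U))) (Ω : ConnForm k e U) :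
    ConnForm k e U where
  Z := gaugeMat h Ω.Z
  Y j := (h : Mat k e (Hol U)) * Ω.Y j * ((h⁻¹ : GL _ _) : Mat k e (Hol U))
    - pderivMat j (h : Mat k e (Hol U)) * ((h⁻¹ : GL _ _) : Mat k e (Hol U))

/-- A framed formal flat deformation: a flat meromorphic connection on the trivial bundle over
`D × U`, with matrix `form` in a fixed trivialization, and a framing `g ∈ GL_n(R)` such that, for
every `y`, the restriction of the connection to `D × {y}` contains the pullback by `g(y)` of a
regular stratum `(P, r, β)` centralized by `T`, that is, its matrix in the trivialization `g(y)`
contains `(P, r, β)`. -/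
structure FramedFlatDeformation (k e r : ℕ) {m : ℕ} (U : TopologicalSpace.Opens (Fin m → ℂ)) where
  form : ConnForm k e U
  flat : form.IsFlat
  g : GL (Fin k × Fin e) (Hol U)
  framed : ∀ y : U, ∃ b : Mat k e ℂ, IsRegularStratum r b ∧
    ContainsStratum r b (evalMat y (form.gauge (constGL g)).Z)

/-- The matrix of the connection in the trivialization given by the framing. -/
def FramedFlatDeformation.framedForm {r : ℕ} (D : FramedFlatDeformation k e r U) :
    ConnForm k e U :=
  D.form.gauge (constGL D.g)

/-- A Laurent series in `z`, constant along `U`. -/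
def constLaurent (U : TopologicalSpace.Opens (Fin m → ℂ)) (x : LaurentSeries ℂ) :
    LaurentSeries (Hol U) :=
  HahnSeries.map x (algebraMap ℂ (Hol U))

/-- `A_{dz/z} = (-r/e) t_{-r} ϖ_T^{-r} + … + (-1/e) t_{-1} ϖ_T^{-1} + t_0`, with `t_i ∈ 𝔱^♭ ⊗ R`. -/
def typeMat (e r : ℕ) (t : ℤ → Fin k → Hol U) : Mat k e (Hol U) :=
  ∑ i ∈ Finset.Icc (-(r : ℤ)) (-1),
    ((i : ℂ) / (e : ℂ)) • (flatMat e (t i) * varpi (Hol U) k e ^ i)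
  + flatMat e (t 0)

/-- For `ν = u dz/z`, the matrix `Ã_ν = (A_{dz/z} + H_T) dz/(z ν)`. -/
def normTypeMat (e r : ℕ) (u : LaurentSeries ℂ) (t : ℤ → Fin k → Hol U) : Mat k e (Hol U) :=
  constLaurent U u⁻¹ • (typeMat e r t + HT (Hol U) k e)

/-- The coefficient of `dy_j` in `A_Δ = ∑_{i=-r}^{-1} ϖ_T^i d_Δ t_i`. -/
def ADelta (e r : ℕ) (t : ℤ → Fin k → Hol U) (j : Fin m) : Mat k e (Hol U) :=
  ∑ i ∈ Finset.Icc (-(r : ℤ)) (-1),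
    varpi (Hol U) k e ^ i * flatMat e (fun a => Hol.pderiv j (t i a))

/-- The matrix of one-forms `Ã_ν ν + A_Δ + f`, for `ν = u dz/z` and the `𝔱^♭`-valued one-form
`f = ∑_j f_j dy_j` on `U`. -/
def totalForm (e r : ℕ) (u : LaurentSeries ℂ) (t : ℤ → Fin k → Hol U)
    (f : Fin m → Fin k → Hol U) : ConnForm k e U where
  Z := constLaurent U u • normTypeMat e r u t
  Y j := ADelta e r t j + flatMat e (f j)

/-- The `𝔱^♭`-valued one-form `∑_j f_j dy_j` is closed. -/
def IsClosedForm (f : Fin m → Fin k → Hol U) : Prop :=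
  ∀ (i j : Fin m) (a : Fin k), Hol.pderiv i (f j a) = Hol.pderiv j (f i a)

/-- The `𝔱^♭`-valued function `s` is constant. -/
def IsConst (s : Fin k → Hol U) : Prop :=
  ∃ c : Fin k → ℂ, ∀ a, s a = algebraMap ℂ (Hol U) (c a)

end

end FormalDeformation

end

noncomputable section

namespace FormalDeformation

open scoped Topology

/-! Flatness is gauge invariant (`ConnForm.IsFlat.gauge`), so both parts concern a flat form whose
`dz/z`-coefficient is `A + H_T`, with `A` the formal type. The shift by `H_T` turns `z∂_z` into the
derivation `grad = z∂_z + ad H_T`, which acts on degree `d` of the filtration's grading as `d/e`.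
The `dz/z ∧ dy_j` equation becomes `grad Y_j + [A, Y_j] = ∂_j A`.

The coefficients `i/e` in `A` are chosen so that `A_Δ` solves this equation up to `∂_j t_0`
(`grad_ADelta`), and `A_Δ` commutes with `A`. Hence `W = Y_j - A_Δ` satisfies `grad W + [A, W] = ∂_j
t_0`. Pairing with `χ_a ϖ^{-d}` kills the commutator and scales by `d/e`: degree `0` gives `∂_j t_0
= 0`, and the other degrees show that the toral components of `W` vanish outside degree `0`. After
subtracting the degree `0` component `f_j ∈ 𝔱^♭`, a horizontal `X` with no toral component remains.

It vanishes pointwise on the polydisk. If `r ≥ 1` and `X ∈ 𝔓^d`, then `[X, A] = grad X ∈ 𝔓^d`, so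
regularity makes `X` toral modulo `𝔓^{d+1}`; its traces vanish, so `X ∈ 𝔓^{d+1}`, for every such `d`
(`eq_zero_of_traceCoeff_eq_zero`). If `r = 0`, the eigenvalues being distinct modulo `ℤ` does the
same job.

The `dy_i ∧ dy_j` equation then says exactly that `f` is closed, because `A_Δ` is closed and
everything commutes. The same curvature formulas give the converse. -/

/-! ### Curvature in a ring with commuting derivations -/

/-- An additive endomorphism satisfying the Leibniz rule. -/
def IsDeriv {A : Type*} [Ring A] (D : A → A) : Prop :=
  (∀ x y, D (x + y) = D x + D y) ∧ ∀ x y, D (x * y) = D x * y + x * D y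

namespace IsDeriv

variable {A : Type*} [Ring A] {D : A → A}

theorem map_add (h : IsDeriv D) (x y : A) : D (x + y) = D x + D y := h.1 x y

theorem map_mul (h : IsDeriv D) (x y : A) : D (x * y) = D x * y + x * D y := h.2 x y

theorem map_zero (h : IsDeriv D) : D 0 = 0 := by
  have := h.1 0 0
  simpa using this

theorem map_sub (h : IsDeriv D) (x y : A) : D (x - y) = D x - D y := by
  have := h.1 (x - y) y
  rw [sub_add_cancel] at this
  rw [this, add_sub_cancel_right]

theorem map_sum (h : IsDeriv D) {ι : Type*} (s : Finset ι) (f : ι → A) :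
    D (∑ i ∈ s, f i) = ∑ i ∈ s, D (f i) := by
  classical
  induction s using Finset.induction_on with
  | empty => simpa using h.map_zero
  | insert a s ha ih => rw [Finset.sum_insert ha, Finset.sum_insert ha, h.map_add, ih]

theorem map_one (h : IsDeriv D) : D 1 = 0 := by
  have := h.2 1 1
  simpa using this

theorem add_ad (h : IsDeriv D) (a : A) : IsDeriv fun x => D x + (a * x - x * a) := by
  refine ⟨fun x y => ?_, fun x y => ?_⟩
  · simp only [h.map_add]; noncomm_ring
  · simp only [h.map_mul]; noncomm_ring

/-- Serves twice for `ϖ_T`: with `c = 1/e` for the grading derivation, and with `c = 0` for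
`∂/∂y_j`. -/
theorem map_units_zpow [Module ℂ A] [IsScalarTower ℂ A A] [SMulCommClass ℂ A A]
    (h : IsDeriv D) {v : Aˣ} {c : ℂ} (hv : D v = c • (v : A)) (i : ℤ) :
    D ((v ^ i : Aˣ) : A) = ((i : ℂ) * c) • ((v ^ i : Aˣ) : A) := by
  induction i using Int.induction_on with
  | zero => simp [h.map_one]
  | succ i ih =>
    rw [zpow_add_one, Units.val_mul, h.map_mul, ih, hv, smul_mul_assoc, mul_smul_comm, ← add_smul]
    push_cast
    ring_nf
  | pred i ih =>
    have e : (v ^ (-(i : ℤ)) : Aˣ) = v ^ (-(i : ℤ) - 1) * v := by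
      rw [← zpow_add_one, sub_add_cancel]
    rw [e, Units.val_mul, h.map_mul, hv, mul_smul_comm] at ih
    -- The downward step is checked after multiplying by the unit `v`, where the Leibniz rule for
    -- `v^(-i-1) * v` applies.
    rw [← sub_eq_zero, ← v.isUnit.mul_left_eq_zero, sub_mul, smul_mul_assoc,
      eq_sub_of_add_eq ih, ← sub_smul, ← sub_smul]
    push_cast
    ring_nf
    simp

end IsDeriv

/-- The curvature of a connection is conjugated by a gauge transformation. -/
theorem curvature_gauge {A : Type*} [Ring A] {D₁ D₂ : A → A} (h₁ : IsDeriv D₁) (h₂ : IsDeriv D₂)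
    (hc : ∀ x, D₁ (D₂ x) = D₂ (D₁ x)) (h : Aˣ) (a b : A) {a' b' : A}
    (ha : a' = h * a * ((h⁻¹ : Aˣ) : A) - D₁ h * ((h⁻¹ : Aˣ) : A))
    (hb : b' = h * b * ((h⁻¹ : Aˣ) : A) - D₂ h * ((h⁻¹ : Aˣ) : A)) :
    (D₁ b' - D₂ a' + (a' * b' - b' * a')) * h = h * (D₁ b - D₂ a + (a * b - b * a)) := by
  -- Clearing `h⁻¹` first means that the derivative of `h⁻¹` is never needed.
  have ha' : a' * h = h * a - D₁ h := by
    rw [ha, sub_mul, Units.inv_mul_cancel_right, Units.inv_mul_cancel_right]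
  have hb' : b' * h = h * b - D₂ h := by
    rw [hb, sub_mul, Units.inv_mul_cancel_right, Units.inv_mul_cancel_right]
  have e1 : D₁ b' * h = D₁ h * b + h * D₁ b - D₁ (D₂ h) - b' * D₁ h := by
    rw [eq_sub_iff_add_eq, ← h₁.map_mul, hb', h₁.map_sub, h₁.map_mul]
  have e2 : D₂ a' * h = D₂ h * a + h * D₂ a - D₂ (D₁ h) - a' * D₂ h := by
    rw [eq_sub_iff_add_eq, ← h₂.map_mul, ha', h₂.map_sub, h₂.map_mul]
  have e3 : a' * b' * h = (h * a - D₁ h) * b - a' * D₂ h := by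
    rw [mul_assoc, hb', mul_sub, ← mul_assoc, ha']
  have e4 : b' * a' * h = (h * b - D₂ h) * a - b' * D₁ h := by
    rw [mul_assoc, ha', mul_sub, ← mul_assoc, hb']
  rw [add_mul, sub_mul, sub_mul, e1, e2, e3, e4, hc]
  noncomm_ring

theorem curvature_gauge_eq_zero {A : Type*} [Ring A] {D₁ D₂ : A → A} (h₁ : IsDeriv D₁)
    (h₂ : IsDeriv D₂) (hc : ∀ x, D₁ (D₂ x) = D₂ (D₁ x)) (h : Aˣ) (a b : A)
    (hab : D₁ b - D₂ a + (a * b - b * a) = 0) {a' b' : A}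
    (ha : a' = h * a * ((h⁻¹ : Aˣ) : A) - D₁ h * ((h⁻¹ : Aˣ) : A))
    (hb : b' = h * b * ((h⁻¹ : Aˣ) : A) - D₂ h * ((h⁻¹ : Aˣ) : A)) :
    D₁ b' - D₂ a' + (a' * b' - b' * a') = 0 := by
  rw [← h.isUnit.mul_left_eq_zero, curvature_gauge h₁ h₂ hc h a b ha hb, hab, mul_zero]

/-! ### Derivations of Laurent series and of matrices of Laurent series -/

section Laurent

variable {S : Type*} [CommRing S]

/-- A derivation can shrink supports; enlarging the index set puts all three products of the Leibniz
rule on the same finite sum. -/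
theorem coeff_mul_of_support_subset {x y : LaurentSeries S} {s t : Set ℤ} (hs : s.IsPWO)
    (ht : t.IsPWO) (hx : x.support ⊆ s) (hy : y.support ⊆ t) (l : ℤ) :
    (x * y).coeff l = ∑ ij ∈ Finset.antidiagonal hs ht l, x.coeff ij.1 * y.coeff ij.2 := by
  rw [HahnSeries.coeff_mul_left' hs hx]
  refine Finset.sum_subset (fun ij => ?_) fun ij h1 h2 => ?_
  · simp only [Finset.mem_antidiagonal]
    exact fun h => ⟨h.1, hy h.2.1, h.2.2⟩
  · simp only [Finset.mem_antidiagonal] at h1 h2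
    have : y.coeff ij.2 = 0 := by
      by_contra h
      exact h2 ⟨h1.1, h, h1.2.2⟩
    rw [this, mul_zero]

@[simp] theorem coeff_zdz (x : LaurentSeries S) (l : ℤ) : (zdz x).coeff l = l • x.coeff l := rfl

theorem isDeriv_zdz : IsDeriv (zdz : LaurentSeries S → LaurentSeries S) := by
  refine ⟨fun x y => by ext l; simp, fun x y => ?_⟩
  ext l
  have hx : (zdz x).support ⊆ x.support := fun l hl h => hl (by simp [h])
  have hy : (zdz y).support ⊆ y.support := fun l hl h => hl (by simp [h])
  rw [coeff_zdz, HahnSeries.coeff_add, HahnSeries.coeff_mul,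
    coeff_mul_of_support_subset x.isPWO_support y.isPWO_support hx subset_rfl,
    coeff_mul_of_support_subset x.isPWO_support y.isPWO_support subset_rfl hy,
    Finset.smul_sum, ← Finset.sum_add_distrib]
  refine Finset.sum_congr rfl fun ij h => ?_
  rw [Finset.mem_antidiagonal] at h
  simp only [← h.2.2, coeff_zdz, zsmul_eq_mul]
  push_cast
  ring

theorem isDeriv_hahnSeries_map {F : Type*} [FunLike F S S] [ZeroHomClass F S S] (D : F)
    (hD : IsDeriv (D : S → S)) :
    IsDeriv fun x : LaurentSeries S => HahnSeries.map x D := by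
  refine ⟨fun x y => by ext l; simp [hD.map_add], fun x y => ?_⟩
  ext l
  have hx : (HahnSeries.map x D).support ⊆ x.support := fun l hl h =>
    hl (by simp [show x.coeff l = 0 from h])
  have hy : (HahnSeries.map y D).support ⊆ y.support := fun l hl h =>
    hl (by simp [show y.coeff l = 0 from h])
  rw [HahnSeries.coeff_add,
    coeff_mul_of_support_subset x.isPWO_support y.isPWO_support hx subset_rfl,
    coeff_mul_of_support_subset x.isPWO_support y.isPWO_support subset_rfl hy,
    HahnSeries.map_coeff, HahnSeries.coeff_mul, hD.map_sum, ← Finset.sum_add_distrib]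
  refine Finset.sum_congr rfl fun ij _ => ?_
  rw [hD.map_mul, HahnSeries.map_coeff, HahnSeries.map_coeff]

theorem isDeriv_matrix_map {n A : Type*} [Fintype n] [DecidableEq n] [Ring A] {D : A → A}
    (hD : IsDeriv D) : IsDeriv fun X : Matrix n n A => X.map D := by
  refine ⟨fun X Y => by ext i j; simp [hD.map_add], fun X Y => ?_⟩
  ext i j
  simp [Matrix.mul_apply, hD.map_sum, hD.map_mul, Finset.sum_add_distrib]

theorem isDeriv_zdzMat {k e : ℕ} : IsDeriv (zdzMat : Mat k e S → Mat k e S) :=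
  isDeriv_matrix_map isDeriv_zdz

end Laurent

/-! ### Partial derivatives of holomorphic functions -/

section Holomorphic

variable {m : ℕ} {U : TopologicalSpace.Opens (Fin m → ℂ)}

theorem Hol.pderiv_apply (j : Fin m) (f : Hol U) (y : U) :
    (Hol.pderiv j f : U → ℂ) y = fderiv ℂ (Hol.ext0 f) y (Pi.single j 1) := rfl

theorem Hol.isDeriv_pderiv (j : Fin m) : IsDeriv (Hol.pderiv j : Hol U → Hol U) := by
  refine ⟨_root_.map_add _, fun f g => ?_⟩
  ext y
  have h : Hol.ext0 (f * g) =ᶠ[𝓝 (y : Fin m → ℂ)] Hol.ext0 f * Hol.ext0 g :=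
    Hol.eventuallyEq_of_forall (fun x => by simp [Hol.ext0_apply]) y
  have hf := (Hol.analytic_ext0 f y y.2).differentiableAt
  have hg := (Hol.analytic_ext0 g y y.2).differentiableAt
  simp only [Hol.pderiv_apply, h.fderiv_eq, fderiv_mul hf hg, Subalgebra.coe_add,
    Subalgebra.coe_mul, Pi.add_apply, Pi.mul_apply, add_apply,
    smul_apply, smul_eq_mul, Hol.ext0_apply]
  ring

theorem Hol.pderiv_comm (i j : Fin m) (f : Hol U) :
    Hol.pderiv i (Hol.pderiv j f) = Hol.pderiv j (Hol.pderiv i f) := by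
  have key : ∀ (i j : Fin m) (y : U), (Hol.pderiv i (Hol.pderiv j f) : U → ℂ) y =
      fderiv ℂ (fderiv ℂ (Hol.ext0 f)) y (Pi.single i 1) (Pi.single j 1) := by
    intro i j y
    have h : Hol.ext0 (Hol.pderiv j f) =ᶠ[𝓝 (y : Fin m → ℂ)]
        fun x => fderiv ℂ (Hol.ext0 f) x (Pi.single j 1) :=
      Hol.eventuallyEq_of_forall (fun x => by rw [Hol.ext0_apply, Hol.pderiv_apply]) y
    have hd := ((Hol.analytic_ext0 f).fderiv y y.2).differentiableAt
    rw [Hol.pderiv_apply, h.fderiv_eq, fderiv_clm_apply hd (differentiableAt_const _)]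
    simp
  ext y
  rw [key, key]
  refine IsSymmSndFDerivAt.eq (ContDiffAt.isSymmSndFDerivAt (n := ⊤)
    (Hol.analytic_ext0 f y y.2).contDiffAt ?_) _ _
  simp

theorem isConst_of_pderiv_eq_zero {c : Fin m → ℂ} {ρ : Fin m → ℝ} (hρ : ∀ i, 0 < ρ i) {k : ℕ}
    (s : Fin k → Hol (polydisk c ρ)) (h : ∀ j a, Hol.pderiv j (s a) = 0) : IsConst s := by
  -- Positive radii provide a base point; the values at the centre are the constants.
  have hc : c ∈ polydisk c ρ := fun i _ => Metric.mem_ball_self (hρ i)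
  refine ⟨fun a => (s a : polydisk c ρ → ℂ) ⟨c, hc⟩, fun a => ?_⟩
  ext y
  have hconn : IsPreconnected (polydisk c ρ : Set (Fin m → ℂ)) :=
    (convex_pi fun i _ => convex_ball (c i) (ρ i)).isPreconnected
  have := IsOpen.is_const_of_fderiv_eq_zero (𝕜 := ℂ) (polydisk c ρ).isOpen hconn
    (f := Hol.ext0 (s a)) (Hol.analytic_ext0 (s a)).differentiableOn
    (fun x hx => by
      refine ContinuousLinearMap.coe_injective (LinearMap.pi_ext' fun j => LinearMap.ext_ring ?_)
      have := congrFun (congrArg Subtype.val (h j a)) ⟨x, hx⟩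
      exact this) y.2 hc
  rw [Hol.ext0_apply (s a) y, Hol.ext0_apply (s a) ⟨c, hc⟩] at this
  rw [this]
  rfl

theorem Hol.pderiv_algebraMap (j : Fin m) (x : ℂ) :
    Hol.pderiv j (algebraMap ℂ (Hol U) x) = 0 := by
  rw [Algebra.algebraMap_eq_smul_one, map_smul, (Hol.isDeriv_pderiv j).map_one, smul_zero]

theorem isDeriv_pderivMat {k e : ℕ} (j : Fin m) :
    IsDeriv (pderivMat j : Mat k e (Hol U) → Mat k e (Hol U)) :=
  isDeriv_matrix_map (isDeriv_hahnSeries_map _ (Hol.isDeriv_pderiv j))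

theorem zdzMat_pderivMat {k e : ℕ} (j : Fin m) (X : Mat k e (Hol U)) :
    zdzMat (pderivMat j X) = pderivMat j (zdzMat X) := by
  ext p q l : 3
  simp [zdzMat, pderivMat, -zsmul_eq_mul]

theorem pderivMat_comm {k e : ℕ} (i j : Fin m) (X : Mat k e (Hol U)) :
    pderivMat i (pderivMat j X) = pderivMat j (pderivMat i X) := by
  ext p q l
  simp [pderivMat, Hol.pderiv_comm i j]

/-- Every curvature component has the shape `D₁ b - D₂ a + [a, b]` for a commuting pair among `z∂_z`
and the `∂/∂y_j`. -/
theorem ConnForm.IsFlat.gauge {k e : ℕ} {Ω : ConnForm k e U} (hΩ : Ω.IsFlat)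
    (h : GL (Fin k × Fin e) (LaurentSeries (Hol U))) : (Ω.gauge h).IsFlat :=
  ⟨fun j => curvature_gauge_eq_zero isDeriv_zdzMat (isDeriv_pderivMat j) (zdzMat_pderivMat j) h
    _ _ (hΩ.1 j) rfl rfl,
  fun i j => curvature_gauge_eq_zero (isDeriv_pderivMat i) (isDeriv_pderivMat j)
    (pderivMat_comm i j) h _ _ (hΩ.2 i j) rfl rfl⟩

end Holomorphic

/-! ### Scalars and Laurent series -/

section

variable {S : Type*} [CommRing S] [Algebra ℂ S]

theorem smul_eq_C_mul (a : ℂ) (x : LaurentSeries S) :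
    a • x = HahnSeries.C (algebraMap ℂ S a) * x := by
  rw [HahnSeries.C_mul_eq_smul]
  ext l
  exact Algebra.smul_def _ _

instance isScalarTower_laurentSeries :
    IsScalarTower ℂ (LaurentSeries S) (LaurentSeries S) :=
  ⟨fun a x y => by simp only [smul_eq_C_mul, smul_eq_mul, mul_assoc]⟩

instance smulCommClass_laurentSeries :
    SMulCommClass ℂ (LaurentSeries S) (LaurentSeries S) :=
  ⟨fun a x y => by simp only [smul_eq_C_mul, smul_eq_mul, mul_left_comm]⟩

end

/-! ### The grading defined by `z ∂_z + ad H_T` -/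

section

variable {S : Type*} [CommRing S] {k e : ℕ}

theorem flatMat_commute (c d : Fin k → S) : Commute (flatMat e c) (flatMat e d) := by
  simp [Commute, SemiconjBy, flatMat, mul_comm]

theorem diagonal_mul_varpi (c : Fin k → LaurentSeries S) :
    Commute (Matrix.diagonal fun p : Fin k × Fin e => c p.1) (varpi S k e) := by
  ext p q : 1
  rw [Matrix.diagonal_mul, Matrix.mul_diagonal]
  by_cases h : p.1 = q.1
  · rw [h, mul_comm]
  · simp [varpi, h]

theorem flatMat_commute_varpi_zpow (c : Fin k → S) (i : ℤ) :
    Commute (flatMat e c) (varpi S k e ^ i) :=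
  Matrix.Commute.zpow_right (diagonal_mul_varpi fun a => HahnSeries.C (c a)) i

theorem flatMat_mul_zpow_commute (c d : Fin k → S) (i j : ℤ) :
    Commute (flatMat e c * varpi S k e ^ i) (flatMat e d * varpi S k e ^ j) :=
  ((flatMat_commute c d).mul_right (flatMat_commute_varpi_zpow c j)).mul_left
    ((flatMat_commute_varpi_zpow d i).symm.mul_right (Matrix.Commute.zpow_zpow_self _ i j))

theorem flatMat_sub (c d : Fin k → S) : flatMat e (c - d) = flatMat e c - flatMat e d := by
  simp [flatMat]

theorem flatMat_commute_HT [Algebra ℂ S] (c : Fin k → S) :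
    Commute (HT S k e) (flatMat e c) := by
  simp [Commute, SemiconjBy, flatMat, HT, mul_comm]

/-- The derivation `z ∂_z + ad H_T`, which multiplies the homogeneous matrices of degree `d` for the
grading of period `e` by `d / e`. -/
def grad [Algebra ℂ S] (X : Mat k e S) : Mat k e S :=
  zdzMat X + (HT S k e * X - X * HT S k e)

theorem isDeriv_grad [Algebra ℂ S] : IsDeriv (grad : Mat k e S → Mat k e S) :=
  isDeriv_zdzMat.add_ad _

/-- The diagonal entries of `H_T` at positions `a` and `b` of a block differ by `(b - a)/e`, and
`z∂_z` contributes `l`. -/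
theorem coeff_grad [Algebra ℂ S] [NeZero e] (X : Mat k e S) (p q : Fin k × Fin e) (l : ℤ) :
    (grad X p q).coeff l =
      (((l * e + (q.2 : ℕ) - (p.2 : ℕ) : ℤ) : ℂ) / (e : ℂ)) • (X p q).coeff l := by
  have he : (e : ℂ) ≠ 0 := NeZero.ne _
  have h2 : ∀ x : LaurentSeries S, ∀ s : S, (x * HahnSeries.C s).coeff l = s * x.coeff l :=
    fun x s => by rw [mul_comm, HahnSeries.C_mul_eq_smul]; rfl
  have h3 : ∀ x : LaurentSeries S, ∀ s : S, (HahnSeries.C s * x).coeff l = s * x.coeff l :=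
    fun x s => by rw [HahnSeries.C_mul_eq_smul]; rfl
  have h4 : (l : ℤ) • (X p q).coeff l = (l : ℂ) • (X p q).coeff l := by
    rw [Int.cast_smul_eq_zsmul]
  simp only [grad, HT, zdzMat, Matrix.add_apply, Matrix.sub_apply, Matrix.map_apply,
    Matrix.diagonal_mul, Matrix.mul_diagonal, HahnSeries.coeff_add, HahnSeries.coeff_sub, coeff_zdz,
    h2, h3, ← Algebra.smul_def]
  rw [h4, ← sub_smul, ← add_smul]
  congr 1
  push_cast
  field_simp
  ring

theorem grad_flatMat [Algebra ℂ S] (c : Fin k → S) : grad (flatMat e c) = 0 := by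
  rw [grad, (flatMat_commute_HT c).eq, sub_self, add_zero]
  ext p q l
  by_cases h : p = q
  · subst h
    by_cases hl : l = 0
    · simp [zdzMat, hl]
    · simp [zdzMat, flatMat, HahnSeries.coeff_single_of_ne hl]
  · simp [zdzMat, flatMat, h]

theorem coeff_varpi {p q : Fin k × Fin e} {l : ℤ} (h : (varpi S k e p q).coeff l ≠ 0) :
    l * e + (q.2 : ℕ) - (p.2 : ℕ) = 1 := by
  simp only [varpi, Matrix.of_apply] at h
  split_ifs at h with h1 h2 h3
  · have hl : l = 0 := by
      by_contra hl
      simp [hl] at h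
    subst hl
    omega
  · have hl : l = 1 := by
      by_contra hl
      simp [HahnSeries.coeff_single_of_ne hl] at h
    subst hl
    omega
  · simp at h
  · simp at h

theorem grad_varpi [Algebra ℂ S] [NeZero e] :
    grad (varpi S k e) = (1 / (e : ℂ)) • varpi S k e := by
  ext p q l
  rw [coeff_grad]
  change _ = (1 / (e : ℂ)) • (varpi S k e p q).coeff l
  by_cases h : (varpi S k e p q).coeff l = 0
  · rw [h, smul_zero, smul_zero]
  · rw [coeff_varpi h, Int.cast_one]

/-- `ϖ_T` as a unit of the matrix algebra. -/
def varpiUnit (S : Type*) [CommRing S] (k e : ℕ) [NeZero e] : (Mat k e S)ˣ :=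
  Matrix.nonsingInvUnit _ (isUnit_det_varpi S k e)

@[simp] theorem coe_varpiUnit [NeZero e] : (varpiUnit S k e : Mat k e S) = varpi S k e := rfl

theorem grad_varpi_zpow [Algebra ℂ S] [NeZero e] (i : ℤ) :
    grad (varpi S k e ^ i) = ((i : ℂ) / (e : ℂ)) • varpi S k e ^ i := by
  have := isDeriv_grad.map_units_zpow (v := varpiUnit S k e) (grad_varpi (S := S)) i
  rwa [Matrix.coe_units_zpow, coe_varpiUnit, mul_one_div] at this

theorem grad_flatMat_mul_zpow [Algebra ℂ S] [NeZero e] (c : Fin k → S) (i : ℤ) :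
    grad (flatMat e c * varpi S k e ^ i)
      = ((i : ℂ) / (e : ℂ)) • (flatMat e c * varpi S k e ^ i) := by
  rw [isDeriv_grad.map_mul, grad_flatMat, zero_mul, zero_add, grad_varpi_zpow, mul_smul_comm]

/-! ### The trace functionals -/

/-- The pairing of the homogeneous component of degree `d` of `X` with `χ_j ϖ_T^{-d}`. -/
def traceCoeff (j : Fin k) (d : ℤ) (X : Mat k e S) : S :=
  (Matrix.trace (flatMat e (Pi.single j 1) * varpi S k e ^ (-d) * X)).coeff 0

theorem traceCoeff_add (j : Fin k) (d : ℤ) (X Y : Mat k e S) :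
    traceCoeff j d (X + Y) = traceCoeff j d X + traceCoeff j d Y := by
  simp [traceCoeff, mul_add]

theorem traceCoeff_sub (j : Fin k) (d : ℤ) (X Y : Mat k e S) :
    traceCoeff j d (X - Y) = traceCoeff j d X - traceCoeff j d Y := by
  simp [traceCoeff, mul_sub]

theorem traceCoeff_commutator (j : Fin k) (d : ℤ) {A : Mat k e S} (X : Mat k e S)
    (hA : Commute (flatMat e (Pi.single j 1) * varpi S k e ^ (-d)) A) :
    traceCoeff j d (A * X - X * A) = 0 := by
  rw [traceCoeff, mul_sub, Matrix.trace_sub, ← mul_assoc, ← mul_assoc,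
    Matrix.trace_mul_comm _ A, ← mul_assoc, hA.eq, sub_self]
  rfl

theorem trace_grad [Algebra ℂ S] (X : Mat k e S) : (grad X).trace = zdz X.trace := by
  rw [grad, Matrix.trace_add, Matrix.trace_sub, Matrix.trace_mul_comm, sub_self, add_zero]
  exact (isDeriv_zdz.map_sum _ _).symm

/-- Integration by parts: the trace of a `grad` is a `z∂_z`, which has no constant coefficient, and
`χ_j ϖ^{-d}` has eigenvalue `-d/e`. -/
theorem traceCoeff_grad [Algebra ℂ S] [NeZero e] (j : Fin k) (d : ℤ) (X : Mat k e S) :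
    traceCoeff j d (grad X) = ((d : ℂ) / (e : ℂ)) • traceCoeff j d X := by
  have h := trace_grad (flatMat e (Pi.single j 1) * varpi S k e ^ (-d) * X)
  rw [isDeriv_grad.map_mul, grad_flatMat_mul_zpow, smul_mul_assoc, Matrix.trace_add,
    Matrix.trace_smul] at h
  have h0 := congrArg (fun x => HahnSeries.coeff x 0) h
  simp only [HahnSeries.coeff_add, HahnSeries.coeff_smul, coeff_zdz, zero_smul] at h0
  rw [traceCoeff, traceCoeff, eq_neg_of_add_eq_zero_right h0, ← neg_smul]
  congr 1
  push_cast
  ring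

theorem traceCoeff_zero (j : Fin k) (X : Mat k e S) :
    traceCoeff j 0 X = ∑ a, (X (j, a) (j, a)).coeff 0 := by
  have h : ∀ p : Fin k × Fin e, ((flatMat e (Pi.single j (1 : S)) * X) p p).coeff 0 =
      if p.1 = j then (X p p).coeff 0 else 0 := by
    intro p
    by_cases h : p.1 = j <;> simp [flatMat, Matrix.diagonal_mul, Pi.single_apply, h]
  rw [traceCoeff, neg_zero, zpow_zero, mul_one, Matrix.trace, HahnSeries.coeff_sum]
  simp only [Matrix.diag_apply, h, Fintype.sum_prod_type]
  rw [Finset.sum_eq_single j]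
  · simp
  · intro b _ hb
    simp [hb]
  · simp

theorem traceCoeff_zero_flatMat (j : Fin k) (c : Fin k → S) :
    traceCoeff j 0 (flatMat e c) = (e : S) * c j := by
  simp [traceCoeff_zero, flatMat]

theorem traceCoeff_flatMat_of_ne [Algebra ℂ S] [NeZero e] (j : Fin k) {d : ℤ} (hd : d ≠ 0)
    (c : Fin k → S) : traceCoeff j d (flatMat e c) = 0 := by
  have h := traceCoeff_grad j d (flatMat e c)
  rw [grad_flatMat] at h
  have h0 : traceCoeff j d (0 : Mat k e S) = 0 := by simp [traceCoeff]
  have hne : ((d : ℂ) / (e : ℂ)) ≠ 0 :=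
    div_ne_zero (Int.cast_ne_zero.2 hd) (NeZero.ne _)
  rw [h0] at h
  rw [← one_smul ℂ (traceCoeff j d _), ← inv_mul_cancel₀ hne, mul_smul, ← h, smul_zero]

/-! ### The lattice chain filtration -/

/-- The monomial `z^l` in the entry `(p, q)` is homogeneous of degree `l e + q.2 - p.2`, so
membership in `𝔓^d` is a bound on degrees. -/
theorem mem_par_iff [Nontrivial S] [NeZero e] {d : ℤ} {X : Mat k e S} :
    X ∈ par S k e d ↔
      ∀ p q l, (X p q).coeff l ≠ 0 → d ≤ l * e + (q.2 : ℕ) - (p.2 : ℕ) := by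
  constructor
  · intro h p q l hl
    -- The column `q` is read off by testing on the basis vector `e_q`, which lies in `L^(e-1-q.2)`.
    have hv : (Pi.single q 1 : Fin k × Fin e → LaurentSeries S) ∈
        chain S k e (e - 1 - (q.2 : ℕ)) := by
      intro j a l' hl'
      by_cases hq : (j, a) = q
      · subst hq
        by_cases h0 : l' = 0
        · subst h0; simp
        · simp [h0] at hl'
      · rw [Pi.single_eq_of_ne hq] at hl'
        simp at hl'
    have := h _ _ hv p.1 p.2 l (by simpa using hl)
    omega
  · intro h i v hv j a l hl
    rw [Matrix.mulVec, dotProduct, HahnSeries.coeff_sum] at hl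
    obtain ⟨q, -, hq⟩ := Finset.exists_ne_zero_of_sum_ne_zero hl
    rw [HahnSeries.coeff_mul] at hq
    obtain ⟨⟨l₁, l₂⟩, hm, hne⟩ := Finset.exists_ne_zero_of_sum_ne_zero hq
    rw [Finset.mem_antidiagonal] at hm
    have h1 := h _ _ _ hm.1
    have h2 := hv _ _ _ hm.2.1
    simp only at h1 h2
    rw [← hm.2.2]
    simp only [add_mul]
    omega

theorem mul_mem_par {c d : ℤ} {X Y : Mat k e S} (hX : X ∈ par S k e c) (hY : Y ∈ par S k e d) :
    X * Y ∈ par S k e (c + d) := by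
  intro i v hv
  rw [← Matrix.mulVec_mulVec, add_comm c d, ← add_assoc]
  exact hX _ _ (hY _ _ hv)

theorem add_mem_par [Nontrivial S] [NeZero e] {d : ℤ} {X Y : Mat k e S} (hX : X ∈ par S k e d)
    (hY : Y ∈ par S k e d) : X + Y ∈ par S k e d := by
  rw [mem_par_iff] at *
  intro p q l hl
  by_cases h : (X p q).coeff l = 0
  · refine hY p q l fun h' => hl ?_
    simp [h, h']
  · exact hX p q l h

theorem par_anti [Nontrivial S] [NeZero e] {c d : ℤ} (h : c ≤ d) {X : Mat k e S}
    (hX : X ∈ par S k e d) : X ∈ par S k e c := by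
  rw [mem_par_iff] at *
  exact fun p q l hl => h.trans (hX p q l hl)

theorem varpi_mem_par [Nontrivial S] [NeZero e] : varpi S k e ∈ par S k e 1 :=
  mem_par_iff.2 fun _ _ _ hl => (coeff_varpi hl).ge

theorem varpi_mulVec_apply (v : Fin k × Fin e → LaurentSeries S) (j : Fin k) {a b : Fin e}
    (h : (a : ℕ) + 1 = b) : (varpi S k e).mulVec v (j, a) = v (j, b) := by
  rw [Matrix.mulVec, dotProduct, Finset.sum_eq_single (j, b)]
  · simp [varpi, h]
  · rintro ⟨j', b'⟩ - hne
    have hb := b.2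
    by_cases hj : j = j'
    · subst hj
      have h1 : (a : ℕ) + 1 ≠ b' := fun h' => hne (by ext <;> simp; omega)
      have h2 : (a : ℕ) + 1 ≠ e := by omega
      simp [varpi, h1, h2]
    · simp [varpi, hj]
  · simp

theorem varpi_mulVec_last (v : Fin k × Fin e → LaurentSeries S) (j : Fin k) {a b : Fin e}
    (ha : (a : ℕ) + 1 = e) (hb : (b : ℕ) = 0) :
    (varpi S k e).mulVec v (j, a) = HahnSeries.single (1 : ℤ) (1 : S) * v (j, b) := by
  rw [Matrix.mulVec, dotProduct, Finset.sum_eq_single (j, b)]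
  · simp [varpi, ha, hb]
    omega
  · rintro ⟨j', b'⟩ - hne
    have hb' := b'.2
    by_cases hj : j = j'
    · subst hj
      have h1 : (a : ℕ) + 1 ≠ b' := by omega
      have h2 : (b' : ℕ) ≠ 0 := fun h' => hne (by ext <;> simp; omega)
      rw [varpi, Matrix.of_apply, if_pos rfl, if_neg h1, if_neg (fun h => h2 h.2), zero_mul]
    · simp [varpi, hj]
  · simp

/-- Multiplying by `ϖ_T` only shifts coordinates, so it can be undone in the chain; this is what
controls negative powers. -/
theorem mem_chain_of_varpi_mulVec [NeZero e] {i : ℤ} {v : Fin k × Fin e → LaurentSeries S}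
    (h : (varpi S k e).mulVec v ∈ chain S k e (i + 1)) : v ∈ chain S k e i := by
  intro j b l hl
  have hb := b.2
  by_cases h0 : (b : ℕ) = 0
  -- Coordinate `0` reappears in the last row multiplied by `z`, hence the exponent `l + 1`.
  · have hlt : e - 1 < e := by omega
    have h1 := h j ⟨e - 1, hlt⟩ (l + 1)
    rw [varpi_mulVec_last v j (by simp; omega) h0, add_comm l,
      HahnSeries.coeff_single_mul, add_sub_cancel_left, one_mul] at h1
    have := h1 hl
    simp only [add_mul] at this
    omega
  · have h1 := h j ⟨b - 1, by omega⟩ l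
    rw [varpi_mulVec_apply v j (b := b) (by simp; omega)] at h1
    have := h1 hl
    simp only at this
    omega

theorem varpi_zpow_mem_par [Nontrivial S] [NeZero e] (i : ℤ) :
    varpi S k e ^ i ∈ par S k e i := by
  have hu := isUnit_det_varpi S k e
  induction i using Int.induction_on with
  | zero =>
    intro i v hv
    simpa using hv
  | succ i ih =>
    rw [Matrix.zpow_add_one hu]
    exact mul_mem_par ih varpi_mem_par
  | pred i ih =>
    intro j v hv
    apply mem_chain_of_varpi_mulVec
    rw [Matrix.mulVec_mulVec, ← Matrix.zpow_one_add hu]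
    have := ih j v hv
    convert this using 1
    · rw [add_assoc, sub_add_cancel]
    · rw [add_sub_cancel]

theorem exists_notMem_par [Nontrivial S] [NeZero e] {X : Mat k e S} (hX : X ≠ 0) :
    ∃ d, X ∉ par S k e d := by
  by_contra! h
  apply hX
  ext p q l
  by_contra hl
  have := mem_par_iff.1 (h (l * e + (q.2 : ℕ) - (p.2 : ℕ) + 1)) p q l hl
  omega

theorem exists_mem_par [Nontrivial S] [NeZero e] (X : Mat k e S) : ∃ d, X ∈ par S k e d := by
  have h1 : ∀ p q, ∃ b : ℤ, ∀ l, (X p q).coeff l ≠ 0 → b ≤ l := fun p q => by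
    exact ⟨(X p q).order, fun l hl => HahnSeries.order_le_of_coeff_ne_zero hl⟩
  choose b hb using h1
  let B : ℤ := ∑ p, ∑ q, |b p q|
  -- `B` bounds all orders in absolute value; the extra `-e` absorbs the difference of positions
  -- inside a block.
  refine ⟨-B * e - e, mem_par_iff.2 fun p q l hl => ?_⟩
  have h2 : |b p q| ≤ B :=
    (Finset.single_le_sum (f := fun q => |b p q|) (fun _ _ => abs_nonneg _) (Finset.mem_univ q)).trans
      (Finset.single_le_sum (f := fun p => ∑ q, |b p q|)
        (fun _ _ => Finset.sum_nonneg fun _ _ => abs_nonneg _) (Finset.mem_univ p))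
  have h3 := hb p q l hl
  have h4 : -B ≤ l := by linarith [neg_abs_le (b p q)]
  have h5 : -B * e ≤ l * e := mul_le_mul_of_nonneg_right h4 (by positivity)
  have := p.2.2
  omega

/-- A nonzero matrix has an order with respect to the filtration. -/
theorem eq_zero_of_forall_mem_par [Nontrivial S] [NeZero e] {X : Mat k e S}
    (h : ∀ d, X ∈ par S k e d → X ∈ par S k e (d + 1)) : X = 0 := by
  by_contra hX
  obtain ⟨d, hd⟩ := exists_notMem_par hX
  obtain ⟨c, hc⟩ := exists_mem_par X
  have : ∀ n : ℕ, X ∈ par S k e (c + n) := fun n => by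
    induction n with
    | zero => simpa using hc
    | succ n ih =>
      push_cast
      rw [← add_assoc]
      exact h _ ih
  exact hd (par_anti (by omega : d ≤ c + (d - c).toNat) (this _))

theorem traceCoeff_of_mem_par [Nontrivial S] [NeZero e] (j : Fin k) (d : ℤ) {X : Mat k e S}
    (hX : X ∈ par S k e (d + 1)) : traceCoeff j d X = 0 := by
  have h1 : varpi S k e ^ (-d) * X ∈ par S k e 1 := by
    have := mul_mem_par (varpi_zpow_mem_par (-d)) hX
    rwa [neg_add_cancel_left] at this
  have h2 : traceCoeff j d X = traceCoeff j 0 (varpi S k e ^ (-d) * X) := by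
    simp [traceCoeff, mul_assoc]
  rw [h2, traceCoeff_zero]
  refine Finset.sum_eq_zero fun a _ => ?_
  by_contra hne
  have := mem_par_iff.1 h1 _ _ _ hne
  simp at this

/-! ### The torus and the filtration. -/

theorem toral_commute_varpi (c : Fin k → Fin e → LaurentSeries S) :
    Commute (toral c) (varpi S k e) :=
  Commute.sum_left _ _ _ fun a _ =>
    (diagonal_mul_varpi fun j => c j a).mul_left (Commute.pow_self _ _)

theorem toral_commute_flatMat (c : Fin k → Fin e → LaurentSeries S) (s : Fin k → S) :
    Commute (toral c) (flatMat e s) := by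
  refine Commute.sum_left _ _ _ fun a _ => Commute.mul_left ?_ ?_
  · simp [Commute, SemiconjBy, flatMat, mul_comm]
  · exact (diagonal_mul_varpi fun a => HahnSeries.C (s a)).symm.pow_left _

theorem mul_varpi_apply (Y : Mat k e S) (p : Fin k × Fin e) (j : Fin k) {a b : Fin e}
    (h : (a : ℕ) + 1 = b) : (Y * varpi S k e) p (j, b) = Y p (j, a) := by
  rw [Matrix.mul_apply, Finset.sum_eq_single (j, a)]
  · simp [varpi, h]
  · rintro ⟨j', a'⟩ - hne
    by_cases hj : j' = j
    · subst hj
      have h1 : (a' : ℕ) + 1 ≠ b := fun h' => hne (by ext <;> simp; omega)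
      have h2 : (b : ℕ) ≠ 0 := by omega
      rw [varpi, Matrix.of_apply, if_pos rfl, if_neg h1, if_neg (fun h => h2 h.2), mul_zero]
    · simp [varpi, hj]
  · simp

theorem varpi_mul_apply (Y : Mat k e S) (q : Fin k × Fin e) (j : Fin k) {a b : Fin e}
    (h : (a : ℕ) + 1 = b) : (varpi S k e * Y) (j, a) q = Y (j, b) q :=
  varpi_mulVec_apply (fun p => Y p q) j h

/-- Only constant diagonal coefficients can survive in degree `0`: commuting with the `χ_j` excludes
entries outside the blocks. Commuting with `ϖ_T` makes the diagonal constant along each block, so a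
zero block trace kills it, `e` being invertible. -/
theorem mem_par_one_of_commute [Algebra ℂ S] [Nontrivial S] [NeZero e] {Y : Mat k e S}
    (hY : Y ∈ par S k e 0)
    (h1 : Commute Y (varpi S k e)) (h2 : ∀ s : Fin k → S, Commute Y (flatMat e s))
    (h3 : ∀ j, traceCoeff j 0 Y = 0) : Y ∈ par S k e 1 := by
  have hsucc : ∀ (j : Fin k) (a b : Fin e), (a : ℕ) + 1 = b → Y (j, a) (j, a) = Y (j, b) (j, b) := by
    intro j a b h
    rw [← mul_varpi_apply Y (j, a) j h, h1.eq, varpi_mul_apply Y _ j h]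
  have he : 0 < e := Nat.pos_of_ne_zero (NeZero.ne e)
  have hconst : ∀ (j : Fin k) (n : ℕ) (h : n < e), Y (j, ⟨n, h⟩) (j, ⟨n, h⟩)
      = Y (j, ⟨0, he⟩) (j, ⟨0, he⟩) := by
    intro j n
    induction n with
    | zero => intro h; rfl
    | succ n ih =>
      intro h
      rw [← ih (by omega)]
      exact (hsucc j _ _ rfl).symm
  have hdiag : ∀ (j : Fin k) (a : Fin e), (Y (j, a) (j, a)).coeff 0 = 0 := by
    intro j a
    have h4 := h3 j
    rw [traceCoeff_zero, Finset.sum_congr rfl fun b _ => by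
      rw [show Y (j, b) (j, b) = Y (j, a) (j, a) from
        (hconst j b b.2).trans (hconst j a a.2).symm]] at h4
    rw [Finset.sum_const, Finset.card_univ, Fintype.card_fin, ← Nat.cast_smul_eq_nsmul ℂ] at h4
    have hne : (e : ℂ) ≠ 0 := NeZero.ne _
    have := congrArg (fun x => (e : ℂ)⁻¹ • x) h4
    simpa [smul_smul, inv_mul_cancel₀ hne, -Algebra.smul_mul_assoc] using this
  rw [mem_par_iff] at hY ⊢
  intro p q l hl
  have h5 := hY p q l hl
  by_contra h6
  have hp := p.2.2
  have hq := q.2.2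
  have h7 : l * e = (p.2 : ℕ) - (q.2 : ℕ) := by omega
  -- Positions in a block differ by less than `e`, so a multiple of `e` equal to such a difference
  -- is zero.
  have h8 : l = 0 := by
    have ha : l < 1 := by
      by_contra hc
      have : (1 : ℤ) * e ≤ l * e := mul_le_mul_of_nonneg_right (by omega) (by positivity)
      omega
    have hb : -1 < l := by
      by_contra hc
      have : l * e ≤ (-1 : ℤ) * e := mul_le_mul_of_nonneg_right (by omega) (by positivity)
      omega
    omega
  subst h8
  have h9 : p.2 = q.2 := Fin.ext (by omega)
  by_cases hj : p.1 = q.1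
  · have : p = q := Prod.ext hj h9
    subst this
    exact hl (hdiag p.1 p.2)
  · have := congrFun (congrFun (h2 (Pi.single p.1 1)).eq p) q
    rw [flatMat, Matrix.mul_diagonal, Matrix.diagonal_mul] at this
    simp [Ne.symm hj] at this
    simp [← this] at hl

/-- Multiplication by `ϖ_T^{-d}` reduces to degree `0` and stays in the commutant of `ϖ_T` and
`𝔱^♭`. -/
theorem toral_mem_par_succ [Algebra ℂ S] [Nontrivial S] [NeZero e]
    {c : Fin k → Fin e → LaurentSeries S} {d : ℤ}
    (hc : toral c ∈ par S k e d) (h : ∀ j, traceCoeff j d (toral c) = 0) :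
    toral c ∈ par S k e (d + 1) := by
  have hu := isUnit_det_varpi S k e
  have h0 : varpi S k e ^ (-d) * toral c ∈ par S k e 0 := by
    have := mul_mem_par (varpi_zpow_mem_par (-d)) hc
    rwa [neg_add_cancel] at this
  have h1 : varpi S k e ^ (-d) * toral c ∈ par S k e 1 :=
    mem_par_one_of_commute h0
      ((Matrix.Commute.zpow_self _ _).mul_left (toral_commute_varpi c))
      (fun s => (flatMat_commute_varpi_zpow s _).symm.mul_left (toral_commute_flatMat c s))
      (fun j => by
        rw [← h j]
        simp [traceCoeff, mul_assoc])
  have := mul_mem_par (varpi_zpow_mem_par d) h1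
  rwa [← mul_assoc, ← Matrix.zpow_add hu, add_neg_cancel, zpow_zero, one_mul] at this

end

/-! ### Vanishing of horizontal endomorphisms orthogonal to the torus -/

section

variable {k e : ℕ} [NeZero e]

theorem grad_mem_par {d : ℤ} {X : Mat k e ℂ} (hX : X ∈ par ℂ k e d) :
    grad X ∈ par ℂ k e d := by
  rw [mem_par_iff] at *
  intro p q l hl
  refine hX p q l fun h => hl ?_
  rw [coeff_grad, h, smul_zero]

/-- Successive approximation: the kernel condition of the regular stratum supplies a toral leading
term, and the vanishing traces remove it. -/
theorem eq_zero_of_traceCoeff_eq_zero {r : ℕ} (hr : 1 ≤ r) {A X : Mat k e ℂ}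
    (hA : IsRegularStratum r A) (h : grad X + (A * X - X * A) = 0)
    (h0 : ∀ j d, traceCoeff j d X = 0) : X = 0 := by
  refine eq_zero_of_forall_mem_par fun d hd => ?_
  have h1 : X * A - A * X ∈ par ℂ k e (d - r + 1) := by
    have : X * A - A * X = grad X := by
      rw [← neg_sub, neg_eq_iff_add_eq_zero, add_comm]; exact h
    rw [this]
    -- Here `r ≥ 1` enters: `d - r + 1 ≤ d`.
    exact par_anti (by omega) (grad_mem_par hd)
  obtain ⟨c, hc, hXc⟩ := (hA.ker_ad d X hd).1 h1
  have h2 : toral c ∈ par ℂ k e (d + 1) := by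
    refine toral_mem_par_succ hc fun j => ?_
    have := traceCoeff_of_mem_par j d hXc
    rwa [traceCoeff_sub, h0, zero_sub, neg_eq_zero] at this
  simpa using add_mem_par hXc h2

/-- For `r = 0` coprimality forces `e = 1`, and the operator has eigenvalue `l + s_p - s_q` on `z^l
E_pq`. Non-resonance leaves only the constant diagonal, which the traces detect. -/
theorem eq_zero_of_traceCoeff_eq_zero_of_flatMat {s : Fin k → ℂ} {X : Mat k e ℂ}
    (hA : IsRegularStratum 0 (flatMat e s)) (h : grad X + (flatMat e s * X - X * flatMat e s) = 0)
    (h0 : ∀ j, traceCoeff j 0 X = 0) : X = 0 := by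
  obtain rfl : e = 1 := by simpa using hA.coprime
  obtain ⟨hn, hd⟩ := hA.distinct rfl
  have hm : ((flatMat 1 s : Mat k 1 ℂ).map fun x => x.coeff 0)
      = Matrix.diagonal fun p : Fin k × Fin 1 => s p.1 := by
    ext p q
    by_cases hpq : p = q
    · simp [flatMat, hpq]
    · simp [flatMat, hpq]
  have hroots : ((flatMat 1 s : Mat k 1 ℂ).map fun x => x.coeff 0).charpoly.roots
      = Finset.univ.val.map fun p : Fin k × Fin 1 => s p.1 := by
    rw [hm, Matrix.charpoly_diagonal, Finset.prod_eq_multiset_prod,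
      ← Polynomial.roots_multiset_prod_X_sub_C (Finset.univ.val.map fun p : Fin k × Fin 1 => s p.1),
      Multiset.map_map]
    rfl
  rw [hroots] at hn hd
  ext p q l
  by_contra hl
  have h1 := congrArg (fun x => HahnSeries.coeff x l) (congrFun (congrFun h p) q)
  have h2 : (((l : ℂ) + s p.1 - s q.1)) * (X p q).coeff l = 0 := by
    simp only [flatMat, Matrix.add_apply, Matrix.sub_apply, HahnSeries.coeff_add, coeff_grad,
      HahnSeries.coeff_sub, Matrix.diagonal_mul, Matrix.mul_diagonal, Matrix.zero_apply,
      HahnSeries.coeff_zero, mul_comm (X p q), HahnSeries.C_mul_eq_smul, HahnSeries.coeff_smul,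
      smul_eq_mul, Fin.val_eq_zero] at h1
    rw [← h1]
    push_cast
    ring
  have h3 : s q.1 - s p.1 = l := by
    have := (mul_eq_zero.1 h2).resolve_right hl
    linear_combination -this
  have hmem : ∀ p : Fin k × Fin 1, s p.1 ∈ Finset.univ.val.map fun p : Fin k × Fin 1 => s p.1 :=
    fun p => Multiset.mem_map_of_mem _ (Finset.mem_univ p)
  have h4 := hd _ (hmem q) _ (hmem p) l h3
  have h5 : q = p := Multiset.inj_on_of_nodup_map hn q (Finset.mem_univ q) p (Finset.mem_univ p) h4
  subst h5
  have h6 : l = 0 := by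
    rw [sub_self] at h3
    exact_mod_cast h3.symm
  subst h6
  apply hl
  have := h0 q.1
  rw [traceCoeff_zero, Fin.sum_univ_one] at this
  have hq : q = (q.1, 0) := Prod.ext rfl (Subsingleton.elim _ _)
  rw [hq]
  exact this

end

/-! ### Change of coefficients -/

section

variable {S T : Type*} [CommRing S] [CommRing T] {k e : ℕ}

theorem hahnSeries_map_C {F : Type*} [FunLike F S T] [ZeroHomClass F S T] (φ : F) (s : S) :
    HahnSeries.map (HahnSeries.C s : LaurentSeries S) φ = HahnSeries.C (φ s) := by
  ext l : 2
  by_cases hl : l = 0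
  · simp [hl]
  · simp [hl]

/-- The map `S((z)) → T((z))` induced by a ring homomorphism. -/
def laurentMap (φ : S →+* T) : LaurentSeries S →+* LaurentSeries T where
  toFun x := HahnSeries.map x φ
  map_one' := by
    have := hahnSeries_map_C φ 1
    rwa [map_one, map_one, map_one] at this
  map_zero' := by ext l; simp
  map_add' x y := by ext l; simp
  map_mul' x y := HahnSeries.map_mul (φ : S →ₙ+* T)

@[simp] theorem coeff_laurentMap (φ : S →+* T) (x : LaurentSeries S) (l : ℤ) :
    (laurentMap φ x).coeff l = φ (x.coeff l) := rfl

@[simp] theorem laurentMap_C (φ : S →+* T) (s : S) :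
    laurentMap φ (HahnSeries.C s) = HahnSeries.C (φ s) :=
  hahnSeries_map_C φ s

theorem mapMatrix_flatMat (φ : S →+* T) (c : Fin k → S) :
    (laurentMap φ).mapMatrix (flatMat e c) = flatMat e (φ ∘ c) := by
  rw [flatMat, flatMat, RingHom.mapMatrix_apply, Matrix.diagonal_map (map_zero _)]
  simp only [Function.comp_def, laurentMap_C]

theorem mapMatrix_varpi (φ : S →+* T) :
    (laurentMap φ).mapMatrix (varpi S k e) = varpi T k e := by
  ext p q l
  simp only [varpi, RingHom.mapMatrix_apply, Matrix.map_apply, Matrix.of_apply]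
  split_ifs
  · simp
  · by_cases hl : l = 1
    · simp [hl]
    · simp [HahnSeries.coeff_single_of_ne hl]
  · simp
  · simp

theorem mapMatrix_varpi_zpow [NeZero e] (φ : S →+* T) (i : ℤ) :
    (laurentMap φ).mapMatrix (varpi S k e ^ i) = varpi T k e ^ i := by
  -- Working with units lets the homomorphism pass through negative powers as well.
  have hu : Units.map ((laurentMap φ).mapMatrix (m := Fin k × Fin e)).toMonoidHom
      (varpiUnit S k e) = varpiUnit T k e := Units.ext (mapMatrix_varpi φ)
  rw [← coe_varpiUnit, ← coe_varpiUnit, ← Matrix.coe_units_zpow, ← Matrix.coe_units_zpow, ← hu,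
    ← map_zpow]
  rfl

theorem traceCoeff_mapMatrix [NeZero e] (φ : S →+* T) (j : Fin k) (d : ℤ) (X : Mat k e S) :
    traceCoeff j d ((laurentMap φ).mapMatrix X) = φ (traceCoeff j d X) := by
  have h : flatMat e (Pi.single j (1 : T)) = (laurentMap φ).mapMatrix (flatMat e (Pi.single j 1)) := by
    rw [mapMatrix_flatMat]
    congr 1
    ext a
    by_cases ha : a = j
    · subst ha; simp
    · simp [ha]
  rw [traceCoeff, h, ← mapMatrix_varpi_zpow φ, ← map_mul, ← map_mul, RingHom.mapMatrix_apply,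
    ← AddMonoidHom.map_trace]
  rfl

theorem mapMatrix_grad [Algebra ℂ S] [Algebra ℂ T] (φ : S →+* T)
    (hφ : ∀ a : ℂ, φ (algebraMap ℂ S a) = algebraMap ℂ T a) (X : Mat k e S) :
    (laurentMap φ).mapMatrix (grad X) = grad ((laurentMap φ).mapMatrix X) := by
  have h : (laurentMap φ).mapMatrix (HT S k e) = HT T k e := by
    rw [HT, HT, RingHom.mapMatrix_apply, Matrix.diagonal_map (map_zero _)]
    simp only [laurentMap_C, hφ]
  have h' : (laurentMap φ).mapMatrix (zdzMat X) = zdzMat ((laurentMap φ).mapMatrix X) := by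
    ext p q l
    simp [zdzMat, -zsmul_eq_mul, map_zsmul]
  rw [grad, grad, map_add, map_sub, map_mul, map_mul, h, h']

end

/-! ### The normal form -/

section

variable {m : ℕ} {U : TopologicalSpace.Opens (Fin m → ℂ)} {k e r : ℕ}

theorem evalMat_eq_mapMatrix (y : U) (X : Mat k e (Hol U)) :
    evalMat y X = (laurentMap (Hol.eval y)).mapMatrix X := rfl

theorem eq_zero_of_forall_evalMat {X : Mat k e (Hol U)} (h : ∀ y, evalMat y X = 0) : X = 0 := by
  ext p q l y
  exact congrArg (fun x => HahnSeries.coeff x l) (congrFun (congrFun (h y) p) q)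

/-- The factor `u` cancels, so the choice of `ν` does not affect the equations. -/
theorem constLaurent_smul_normTypeMat {u : LaurentSeries ℂ} (hu : u ≠ 0)
    (t : ℤ → Fin k → Hol U) :
    constLaurent U u • normTypeMat e r u t = typeMat e r t + HT (Hol U) k e := by
  have h : constLaurent U u * constLaurent U u⁻¹ = 1 := by
    change laurentMap _ u * laurentMap _ u⁻¹ = 1
    rw [← map_mul, mul_inv_cancel₀ hu, map_one]
  rw [normTypeMat, smul_smul, h, one_smul]

/-! ### Derivatives along the polydisk. -/

theorem pderivMat_diagonal_C (j : Fin m) (c : Fin k × Fin e → Hol U) :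
    pderivMat j (Matrix.diagonal fun p => HahnSeries.C (c p) : Mat k e (Hol U))
      = Matrix.diagonal fun p => HahnSeries.C (Hol.pderiv j (c p)) := by
  have h0 : HahnSeries.map (0 : LaurentSeries (Hol U)) (Hol.pderiv j) = 0 := by
    ext l : 2; simp
  rw [pderivMat, Matrix.diagonal_map h0]
  congr 1
  ext p : 1
  exact hahnSeries_map_C (Hol.pderiv j) (c p)

theorem pderivMat_flatMat (j : Fin m) (c : Fin k → Hol U) :
    pderivMat j (flatMat e c) = flatMat e fun a => Hol.pderiv j (c a) :=
  pderivMat_diagonal_C j _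

theorem pderivMat_HT (j : Fin m) : pderivMat j (HT (Hol U) k e) = 0 := by
  rw [HT, pderivMat_diagonal_C]
  simp [Hol.pderiv_algebraMap]

theorem pderivMat_smul (j : Fin m) (a : ℂ) (X : Mat k e (Hol U)) :
    pderivMat j (a • X) = a • pderivMat j X := by
  ext p q l : 3
  exact map_smul (Hol.pderiv j) a _

theorem pderivMat_varpi (j : Fin m) : pderivMat j (varpi (Hol U) k e) = 0 := by
  have h1 : Hol.pderiv j (1 : Hol U) = 0 := (Hol.isDeriv_pderiv j).map_one
  ext p q l : 3
  simp only [pderivMat, varpi, Matrix.map_apply, Matrix.of_apply, Matrix.zero_apply,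
    HahnSeries.map_coeff, HahnSeries.coeff_zero]
  split_ifs
  · by_cases hl : l = 0
    · simp [hl, h1]
    · simp [hl]
  · by_cases hl : l = 1
    · simp [hl, h1]
    · simp [HahnSeries.coeff_single_of_ne hl]
  · simp
  · simp

theorem pderivMat_varpi_zpow [NeZero e] (j : Fin m) (i : ℤ) :
    pderivMat j (varpi (Hol U) k e ^ i) = 0 := by
  have := (isDeriv_pderivMat j).map_units_zpow (v := varpiUnit (Hol U) k e) (c := 0)
    (by rw [coe_varpiUnit, pderivMat_varpi, zero_smul]) i
  rwa [Matrix.coe_units_zpow, coe_varpiUnit, mul_zero, zero_smul] at this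

theorem pderivMat_flatMat_mul_zpow [NeZero e] (j : Fin m) (c : Fin k → Hol U) (i : ℤ) :
    pderivMat j (flatMat e c * varpi (Hol U) k e ^ i)
      = flatMat e (fun a => Hol.pderiv j (c a)) * varpi (Hol U) k e ^ i := by
  rw [(isDeriv_pderivMat j).map_mul, pderivMat_varpi_zpow, mul_zero, add_zero, pderivMat_flatMat]

theorem pderivMat_typeMat [NeZero e] (j : Fin m) (t : ℤ → Fin k → Hol U) :
    pderivMat j (typeMat e r t)
      = (∑ i ∈ Finset.Icc (-(r : ℤ)) (-1), ((i : ℂ) / (e : ℂ)) •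
          (flatMat e (fun a => Hol.pderiv j (t i a)) * varpi (Hol U) k e ^ i))
        + flatMat e fun a => Hol.pderiv j (t 0 a) := by
  rw [typeMat, (isDeriv_pderivMat j).map_add, (isDeriv_pderivMat j).map_sum, pderivMat_flatMat]
  simp only [pderivMat_smul, pderivMat_flatMat_mul_zpow]

theorem ADelta_eq (t : ℤ → Fin k → Hol U) (j : Fin m) :
    ADelta e r t j = ∑ i ∈ Finset.Icc (-(r : ℤ)) (-1),
      flatMat e (fun a => Hol.pderiv j (t i a)) * varpi (Hol U) k e ^ i :=
  Finset.sum_congr rfl fun _ _ => ((flatMat_commute_varpi_zpow _ _).eq).symm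

/-! ### Commutation and curvature of the normal form. -/

theorem flatMat_mul_zpow_commute_typeMat (c : Fin k → Hol U) (d : ℤ) (t : ℤ → Fin k → Hol U) :
    Commute (flatMat e c * varpi (Hol U) k e ^ d) (typeMat e r t) := by
  refine Commute.add_right (Commute.sum_right _ _ _ fun i _ => ?_) ?_
  · exact (flatMat_mul_zpow_commute c (t i) d i).smul_right _
  · simpa using flatMat_mul_zpow_commute (e := e) c (t 0) d 0

theorem flatMat_mul_zpow_commute_ADelta (c : Fin k → Hol U) (d : ℤ) (t : ℤ → Fin k → Hol U)
    (j : Fin m) : Commute (flatMat e c * varpi (Hol U) k e ^ d) (ADelta e r t j) := by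
  rw [ADelta_eq]
  exact Commute.sum_right _ _ _ fun i _ => flatMat_mul_zpow_commute c _ d i

theorem flatMat_commute_typeMat (c : Fin k → Hol U) (t : ℤ → Fin k → Hol U) :
    Commute (flatMat e c) (typeMat e r t) := by
  simpa using flatMat_mul_zpow_commute_typeMat (e := e) (r := r) c 0 t

theorem flatMat_commute_ADelta (c : Fin k → Hol U) (t : ℤ → Fin k → Hol U) (j : Fin m) :
    Commute (flatMat e c) (ADelta e r t j) := by
  simpa using flatMat_mul_zpow_commute_ADelta (e := e) (r := r) c 0 t j

theorem ADelta_commute_typeMat (t : ℤ → Fin k → Hol U) (j : Fin m) :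
    Commute (ADelta e r t j) (typeMat e r t) := by
  rw [ADelta_eq]
  exact Commute.sum_left _ _ _ fun i _ => flatMat_mul_zpow_commute_typeMat _ i t

theorem ADelta_commute (t : ℤ → Fin k → Hol U) (i j : Fin m) :
    Commute (ADelta e r t i) (ADelta e r t j) := by
  rw [ADelta_eq t i]
  exact Commute.sum_left _ _ _ fun _ _ => flatMat_mul_zpow_commute_ADelta _ _ t j

/-- The factor `i/e` produced by `grad` in degree `i` is the coefficient of `t_i ϖ_T^i` in `A`; only
`t_0`, of degree `0`, is missed. -/
theorem grad_ADelta [NeZero e] (t : ℤ → Fin k → Hol U) (j : Fin m) :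
    grad (ADelta e r t j)
      = pderivMat j (typeMat e r t) - flatMat e fun a => Hol.pderiv j (t 0 a) := by
  rw [pderivMat_typeMat, add_sub_cancel_right, ADelta_eq, isDeriv_grad.map_sum]
  exact Finset.sum_congr rfl fun i _ => grad_flatMat_mul_zpow _ i

theorem pderivMat_ADelta_comm [NeZero e] (t : ℤ → Fin k → Hol U) (i j : Fin m) :
    pderivMat i (ADelta e r t j) = pderivMat j (ADelta e r t i) := by
  rw [ADelta_eq, ADelta_eq, (isDeriv_pderivMat i).map_sum, (isDeriv_pderivMat j).map_sum]
  refine Finset.sum_congr rfl fun l _ => ?_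
  rw [pderivMat_flatMat_mul_zpow, pderivMat_flatMat_mul_zpow]
  simp only [Hol.pderiv_comm i j]

/-- The `dz/z ∧ dy_j` part of the curvature in terms of the grading derivation. -/
theorem curvature_eq_grad (j : Fin m) (A Y : Mat k e (Hol U)) :
    zdzMat Y - pderivMat j (A + HT (Hol U) k e)
        + ((A + HT (Hol U) k e) * Y - Y * (A + HT (Hol U) k e))
      = grad Y + (A * Y - Y * A) - pderivMat j A := by
  rw [(isDeriv_pderivMat j).map_add, pderivMat_HT, add_zero, grad]
  noncomm_ring

theorem curvature_normal_form [NeZero e] (t : ℤ → Fin k → Hol U) (f : Fin k → Hol U) (j : Fin m) :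
    grad (ADelta e r t j + flatMat e f)
        + (typeMat e r t * (ADelta e r t j + flatMat e f)
          - (ADelta e r t j + flatMat e f) * typeMat e r t) - pderivMat j (typeMat e r t)
      = -flatMat e fun a => Hol.pderiv j (t 0 a) := by
  rw [((ADelta_commute_typeMat t j).add_left (flatMat_commute_typeMat f t)).eq, sub_self, add_zero,
    isDeriv_grad.map_add, grad_flatMat, grad_ADelta]
  abel

theorem curvature_tangential [NeZero e] (t : ℤ → Fin k → Hol U) (f : Fin m → Fin k → Hol U)
    (i j : Fin m) :
    pderivMat i (ADelta e r t j + flatMat e (f j)) - pderivMat j (ADelta e r t i + flatMat e (f i))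
        + ((ADelta e r t i + flatMat e (f i)) * (ADelta e r t j + flatMat e (f j))
          - (ADelta e r t j + flatMat e (f j)) * (ADelta e r t i + flatMat e (f i)))
      = flatMat e ((fun a => Hol.pderiv i (f j a)) - fun a => Hol.pderiv j (f i a)) := by
  have hc : Commute (ADelta e r t i + flatMat e (f i)) (ADelta e r t j + flatMat e (f j)) :=
    ((ADelta_commute t i j).add_right (flatMat_commute_ADelta _ t i).symm).add_left
      ((flatMat_commute_ADelta _ t j).add_right (flatMat_commute _ _))
  rw [hc.eq, sub_self, add_zero, (isDeriv_pderivMat i).map_add, (isDeriv_pderivMat j).map_add,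
    pderivMat_ADelta_comm t i j, pderivMat_flatMat, pderivMat_flatMat, flatMat_sub]
  abel

theorem isFlat_totalForm [NeZero e] {u : LaurentSeries ℂ} (hu : u ≠ 0) {t : ℤ → Fin k → Hol U}
    {f : Fin m → Fin k → Hol U} (hf : IsClosedForm f) (ht : IsConst (t 0)) :
    (totalForm e r u t f).IsFlat := by
  refine ⟨fun j => ?_, fun i j => ?_⟩
  · obtain ⟨c, hc⟩ := ht
    simp only [totalForm]
    rw [constLaurent_smul_normTypeMat hu, curvature_eq_grad, curvature_normal_form]
    simp [hc, Hol.pderiv_algebraMap, flatMat]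
  · simp only [totalForm]
    rw [curvature_tangential]
    simp [hf i j, flatMat]

theorem flatMat_injective {S : Type*} [CommRing S] [NeZero e] :
    Function.Injective (flatMat e : (Fin k → S) → Mat k e S) := by
  intro c d h
  ext a
  have := congrFun (congrFun h (a, 0)) (a, 0)
  simp only [flatMat, Matrix.diagonal_apply_eq] at this
  exact HahnSeries.C_injective this

/-- Horizontal endomorphisms for a family of formal types are elements of `𝔱^♭`. -/
theorem exists_flatMat_of_grad_eq [NeZero e] {t : ℤ → Fin k → Hol U}
    (ht : ∀ y, IsRegularStratum r (evalMat y (typeMat e r t))) {W : Mat k e (Hol U)}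
    {s : Fin k → Hol U}
    (hW : grad W + (typeMat e r t * W - W * typeMat e r t) = flatMat e s) :
    s = 0 ∧ ∃ f, W = flatMat e f := by
  have he : (e : ℂ) ≠ 0 := NeZero.ne _
  -- The toral components of the equation: `A` commutes with the torus, so its commutator
  -- disappears.
  have key : ∀ (j : Fin k) (d : ℤ),
      ((d : ℂ) / (e : ℂ)) • traceCoeff j d W = traceCoeff j d (flatMat e s) := by
    intro j d
    rw [← hW, traceCoeff_add, traceCoeff_grad,
      traceCoeff_commutator j d W (flatMat_mul_zpow_commute_typeMat _ _ t), add_zero]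
  have hs : s = 0 := by
    ext1 j
    have h := key j 0
    rw [traceCoeff_zero_flatMat, Int.cast_zero, zero_div, zero_smul, ← map_natCast (algebraMap ℂ _),
      ← Algebra.smul_def] at h
    exact (smul_eq_zero.1 h.symm).resolve_left he
  subst hs
  have hflat0 : flatMat e (0 : Fin k → Hol U) = 0 := by simp [flatMat]
  rw [hflat0] at hW
  -- A block of size `e` contributes `e` times its scalar to the trace, hence the factor `e⁻¹`.
  refine ⟨rfl, fun j => (e : ℂ)⁻¹ • traceCoeff j 0 W, ?_⟩
  set f : Fin k → Hol U := fun j => (e : ℂ)⁻¹ • traceCoeff j 0 W with hf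
  rw [← sub_eq_zero]
  have hX0 : ∀ j d, traceCoeff j d (W - flatMat e f) = 0 := by
    intro j d
    rw [traceCoeff_sub]
    by_cases hd : d = 0
    · subst hd
      rw [traceCoeff_zero_flatMat, hf, ← map_natCast (algebraMap ℂ _), ← Algebra.smul_def,
        smul_smul, mul_inv_cancel₀ he, one_smul, sub_self]
    · have h := key j d
      rw [traceCoeff_flatMat_of_ne j hd] at h ⊢
      rw [(smul_eq_zero.1 h).resolve_left (div_ne_zero (Int.cast_ne_zero.2 hd) he), sub_zero]
  have hX : grad (W - flatMat e f)
      + (typeMat e r t * (W - flatMat e f) - (W - flatMat e f) * typeMat e r t) = 0 := by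
    rw [isDeriv_grad.map_sub, grad_flatMat, mul_sub, sub_mul, (flatMat_commute_typeMat f t).eq]
    refine Eq.trans ?_ hW
    abel
  -- Regularity is a condition at each point, so the vanishing is proved after evaluation at `y`.
  refine eq_zero_of_forall_evalMat fun y => ?_
  have hy := congrArg (evalMat y) hX
  have hy0 : ∀ j d, traceCoeff j d (evalMat y (W - flatMat e f)) = 0 := fun j d => by
    rw [evalMat_eq_mapMatrix, traceCoeff_mapMatrix, hX0, map_zero]
  have hr := ht y
  simp only [evalMat_eq_mapMatrix, map_add, map_sub _ (_ * _), map_mul, map_zero] at hy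
  rw [mapMatrix_grad (Hol.eval y) fun a => rfl] at hy
  rcases Nat.eq_zero_or_pos r with rfl | hr'
  · have hA : (laurentMap (Hol.eval y)).mapMatrix (typeMat e 0 t)
        = flatMat e (Hol.eval y ∘ t 0) := by
      rw [← mapMatrix_flatMat]
      simp [typeMat]
    rw [evalMat_eq_mapMatrix, hA] at hr
    rw [hA] at hy
    exact eq_zero_of_traceCoeff_eq_zero_of_flatMat hr hy fun j => hy0 j 0
  · exact eq_zero_of_traceCoeff_eq_zero hr' hr hy hy0

/-- The mixed curvature determines each `Y j` up to `𝔱^♭` and kills `d t_0`; the tangential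
curvature then reduces to `df`. -/
theorem exists_eq_totalForm [NeZero e] {u : LaurentSeries ℂ} (hu : u ≠ 0)
    {t : ℤ → Fin k → Hol U} (ht : ∀ y, IsRegularStratum r (evalMat y (typeMat e r t)))
    {Ω : ConnForm k e U} (hΩ : Ω.IsFlat)
    (hZ : Ω.Z = constLaurent U u • normTypeMat e r u t) :
    (∃ f, IsClosedForm f ∧ Ω = totalForm e r u t f) ∧ ∀ j a, Hol.pderiv j (t 0 a) = 0 := by
  have hW : ∀ j, (fun a => Hol.pderiv j (t 0 a)) = 0 ∧
      ∃ f, Ω.Y j - ADelta e r t j = flatMat e f := by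
    intro j
    apply exists_flatMat_of_grad_eq ht
    have h := hΩ.1 j
    rw [hZ, constLaurent_smul_normTypeMat hu, curvature_eq_grad] at h
    rw [isDeriv_grad.map_sub, grad_ADelta, mul_sub, sub_mul, (ADelta_commute_typeMat t j).eq,
      ← sub_eq_zero, ← h]
    abel
  choose h0 f hf using hW
  have hY : ∀ j, Ω.Y j = ADelta e r t j + flatMat e (f j) := fun j => by rw [← hf j]; abel
  refine ⟨⟨f, fun i j a => ?_, ConnForm.ext hZ (funext hY)⟩, fun j a => congrFun (h0 j) a⟩
  have h := hΩ.2 i j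
  rw [hY, hY, curvature_tangential] at h
  have h' := flatMat_injective (h.trans (by simp [flatMat] : (0 : Mat k e (Hol U)) = flatMat e 0))
  exact sub_eq_zero.1 (congrFun h' a)

end

end FormalDeformation
end

/-! ### The proposition. -/

open FormalDeformation in
theorem proposition4p2 (k e r m : ℕ) [NeZero e]
    (c : Fin m → ℂ) (ρ : Fin m → ℝ) (hρ : ∀ i, 0 < ρ i)
    (u : LaurentSeries ℂ) (hu : u ≠ 0) :
    (∀ (D : FramedFlatDeformation k e r (polydisk c ρ))
        (t : ℤ → Fin k → Hol (polydisk c ρ)),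
        (∀ y, HasFormalType r (evalMat y D.framedForm.Z) (evalMat y (typeMat e r t))) →
        ∀ p ∈ parahoric (Hol (polydisk c ρ)) k e,
          gaugeMat p D.framedForm.Z
            = constLaurent (polydisk c ρ) u • normTypeMat e r u t →
          (∃ f : Fin m → Fin k → Hol (polydisk c ρ),
            IsClosedForm f ∧ D.framedForm.gauge p = totalForm e r u t f) ∧
          IsConst (t 0)) ∧
    (∀ (t : ℤ → Fin k → Hol (polydisk c ρ)) (f : Fin m → Fin k → Hol (polydisk c ρ))
        (q : GL (Fin k × Fin e) (LaurentSeries (Hol (polydisk c ρ)))),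
        IsClosedForm f → IsConst (t 0) →
        ConnForm.IsFlat
          { Z := gaugeMat q⁻¹ (totalForm e r u t f).Z
            Y := fun j =>
              ((q⁻¹ : GL _ _) : Mat k e (Hol (polydisk c ρ))) * (totalForm e r u t f).Y j
                  * (q : Mat k e (Hol (polydisk c ρ)))
                + ((q⁻¹ : GL _ _) : Mat k e (Hol (polydisk c ρ)))
                  * pderivMat j (q : Mat k e (Hol (polydisk c ρ))) }) := by
  refine ⟨fun D t ht p _ hZ => ?_, fun t f q hf ht => ?_⟩
  · obtain ⟨h1, h2⟩ := exists_eq_totalForm hu (fun y => (ht y).isFormalType.regular)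
      ((D.flat.gauge (constGL D.g)).gauge p) hZ
    exact ⟨h1, isConst_of_pderiv_eq_zero hρ _ h2⟩
  · have h := (isFlat_totalForm (r := r) hu hf ht).gauge q⁻¹
    convert h using 1
    refine ConnForm.ext rfl (funext fun j => ?_)
    -- Differentiating `q⁻¹ q = 1` turns `-(∂_j q⁻¹) q`, the gauge term for `q⁻¹`, into `q⁻¹ ∂_j q`.
    have hq := (isDeriv_pderivMat j).map_mul ((q⁻¹ : GL _ _) : Mat k e (Hol (polydisk c ρ))) q
    rw [Units.inv_mul, (isDeriv_pderivMat j).map_one] at hq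
    simp only [ConnForm.gauge, inv_inv]
    rw [eq_neg_of_add_eq_zero_right hq.symm, ← sub_eq_add_neg]
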